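/- Let $\lambda_b,P_b,k,\gamma,\beta>0$, $\alpha>2$ and $\sigma\in\mathbb R$. Base stations (BSs) are the points $b_1,b_2,\dots$ of a homogeneous Poisson point process of intensity $\lambda_b$ in $\mathbb R^2$. A user is at a fixed location; let $r_{ci}$ be its distance to $b_i$ and let the fading gains $h_i$ from $b_i$ to the user be i.i.d. exponential with mean $1$, independent of the BS locations. Let $r_c$ be the distance to the nearest BS and $h_c$ the fading gain of that BS. The user associates to its nearest BS (is a cellular user) if $kP_bh_cr_c^{-\alpha}>\gamma$; let $\mathcal P=\mathbb P[kP_bh_cr_c^{-\alpha}>\gamma]$. Let $$\mathrm{SINR}_c=\frac{P_bh_cr_c^{-\alpha}}{\sum_{i}P_bh_ir_{ci}^{-\alpha}+\sigma^2},$$ where the sum runs over all BSs except the nearest one. The downlink coverage probability of a typical cellular user at target $\beta$ is defined as $$\mathcal C_c=\mathbb E_X\big[\mathbb P[\mathrm{SINR}_c(X)\ge\beta]\big],$$ where $X$ is the distance between a cellular user and its serving BS, i.e. $X$ has the law of $r_c$ conditioned on the event $kP_bh_cr_c^{-\alpha}>\gamma$, and $\mathbb P[\mathrm{SINR}_c(x)\ge\beta]=\mathbb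 P[\mathrm{SINR}_c\ge\beta\mid r_c=x]$ is the coverage probability of a user at distance $x$ from its nearest BS (association enters only through the law of $X$; the inner probability is conditioned on the distance alone). Then $\mathcal P>0$ and $$\mathcal C_c=\frac{2\pi\lambda_b}{\mathcal P}\int_0^\infty r\,e^{-\pi\lambda_br^2}\exp\Big(-\frac{\beta\sigma^2r^\alpha}{P_b}-\frac{\gamma r^\alpha}{kP_b}-2\pi\lambda_b(\beta r^\alpha)^{2/\alpha}L(\alpha,\beta)\Big)\,dr,\qquad L(\alpha,\beta)=\int_{\beta^{-1/\alpha}}^\infty\frac{u}{1+u^\alpha}\,du.$$ If moreover $\alpha=4$, then $$\mathcal C_c=\frac{\pi\lambda_b}{\mathcal P}\sqrt{\frac{\pi kP_b}{4(k\beta\sigma^2+\gamma)}}\exp\Big(\frac{kP_b\pi^2\lambda_b^2}{4(k\beta\sigma^2+\gamma)}\big(\sqrt\beta\arctan\sqrt\beta+1\big)^2\Big)\Big[1-\Phi\Big(\pi\lambda_b\big(1+\sqrt\beta\arctan\sqrt\beta\big)\sqrt{\tfrac{kP_b}{4(k\beta\sigma^2+\gamma)}}\Big)\Big],$$ where $\Phi(x)=\frac{2}{\sqrt\pi}\int_0^xe^{-t^2}\,dt$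 is the probability integral (error function). -/

import Mathlib

open MeasureTheory ProbabilityTheory Set

noncomputable section

namespace CellularD2D

/-- The Euclidean plane in which the network lives. -/
abbrev Plane : Type := EuclideanSpace ℝ (Fin 2)

variable {Ω : Type*} [MeasurableSpace Ω]

/-- The number of points of the random sequence `b` that lie in `B`, counted with multiplicity. -/
def pointCount (b : ℕ → Ω → Plane) (B : Set Plane) (ω : Ω) : ℕ∞ :=
  {i : ℕ | b i ω ∈ B}.encard

/-- The random points `b 0, b 1, …` are an enumeration of a homogeneous Poisson point process of
intensity `lam` in the plane: the number of points in a Borel set `B` of finite area has the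
Poisson law with mean `lam * area B`, and the numbers of points in finitely many pairwise disjoint
Borel sets are independent. The order of the enumeration is arbitrary. -/
structure IsPoissonPointProcess (μ : Measure Ω) (lam : ℝ) (b : ℕ → Ω → Plane) : Prop where
  measurable : ∀ i, Measurable (b i)
  poisson : ∀ B : Set Plane, MeasurableSet B → volume B ≠ ⊤ →
    HasLaw (pointCount b B)
      ((poissonMeasure (lam * volume.real B).toNNReal).map (fun n : ℕ => (n : ℕ∞))) μ
  indep : ∀ (m : ℕ) (B : Fin m → Set Plane), (∀ j, MeasurableSet (B j)) →
    Pairwise (fun i j => Disjoint (B i) (B j)) →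
    iIndepFun (fun j => pointCount b (B j)) μ

/-- Rayleigh fading: the power gains `h i` of the channels from the base stations `b i` to the user
are i.i.d. exponential with mean one, and jointly independent of the base station locations. -/
structure IsRayleighFading (μ : Measure Ω) (b : ℕ → Ω → Plane) (h : ℕ → Ω → ℝ) : Prop where
  measurable : ∀ i, Measurable (h i)
  law : ∀ i, HasLaw (h i) (expMeasure 1) μ
  indep : iIndepFun h μ
  indep_locations : IndepFun (fun ω i => h i ω) (fun ω i => b i ω) μ

/-- The index of the base station nearest to the user at `u` (the least such index; almost surely
there is exactly one nearest base station). -/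
def nearestIdx (b : ℕ → Ω → Plane) (u : Plane) (ω : Ω) : ℕ :=
  sInf {i : ℕ | ∀ j : ℕ, dist u (b i ω) ≤ dist u (b j ω)}

/-- The distance `r_c` from the user at `u` to its nearest base station. -/
def nearestDist (b : ℕ → Ω → Plane) (u : Plane) (ω : Ω) : ℝ :=
  dist u (b (nearestIdx b u ω) ω)

/-- The fading `h_c` on the channel from the nearest base station to the user at `u`. -/
def nearestFading (b : ℕ → Ω → Plane) (h : ℕ → Ω → ℝ) (u : Plane) (ω : Ω) : ℝ :=
  h (nearestIdx b u ω) ω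

/-- The event that the user at `u` chooses the cellular mode, i.e. associates to its nearest base
station: the biased received power `k P h_c r_c ^ (-α)` exceeds the threshold `γ`. -/
def cellularEvent (b : ℕ → Ω → Plane) (h : ℕ → Ω → ℝ) (u : Plane) (k P α γ : ℝ) : Set Ω :=
  {ω | γ < k * P * nearestFading b h u ω * nearestDist b u ω ^ (-α)}

/-- The interference at the user at `u`: the total power received from all base stations other than
the nearest one. -/
def interference (b : ℕ → Ω → Plane) (h : ℕ → Ω → ℝ) (u : Plane) (P α : ℝ) (ω : Ω) : ENNReal :=
  ∑' i : {i : ℕ // i ≠ nearestIdx b u ω},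
    ENNReal.ofReal (P * h i ω * dist u (b i ω) ^ (-α))

/-- The downlink SINR of the user at `u` served by its nearest base station, with noise power
`noise`. It is valued in `[0, ∞]`, so that no convention about divergent series is needed. -/
def sinr (b : ℕ → Ω → Plane) (h : ℕ → Ω → ℝ) (u : Plane) (P α noise : ℝ) (ω : Ω) : ENNReal :=
  ENNReal.ofReal (P * nearestFading b h u ω * nearestDist b u ω ^ (-α)) /
    (interference b h u P α ω + ENNReal.ofReal noise)

/-- The probability that the user at `u` associates to its nearest base station. -/
def associationProb (μ : Measure Ω) (b : ℕ → Ω → Plane) (h : ℕ → Ω → ℝ) (u : Plane)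
    (k P α γ : ℝ) : ℝ :=
  μ.real (cellularEvent b h u k P α γ)

/-- The law of the distance `X` between a typical cellular user and its serving base station: the
law of `r_c` conditioned on the event that the user chooses the cellular mode. -/
def servingDistLaw (μ : Measure Ω) (b : ℕ → Ω → Plane) (h : ℕ → Ω → ℝ) (u : Plane)
    (k P α γ : ℝ) : Measure ℝ :=
  (cond μ (cellularEvent b h u k P α γ)).map (nearestDist b u)

/-- The coverage probability `E_X [ℙ[SINR(X) ≥ β]]` of a typical cellular user: `ℙ[SINR(x) ≥ β]` is
the probability that the SINR of a user at distance `x` from its nearest base station is at least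
`β` (a regular conditional probability given `r_c = x`), and `X` is the distance from a typical
cellular user to its serving base station. -/
def coverageProb (μ : Measure Ω) [IsFiniteMeasure μ] (b : ℕ → Ω → Plane) (h : ℕ → Ω → ℝ)
    (u : Plane) (k P α γ noise β : ℝ) : ℝ :=
  ∫ x, (condDistrib (sinr b h u P α noise) (nearestDist b u) μ x).real
      {s | ENNReal.ofReal β ≤ s} ∂(servingDistLaw μ b h u k P α γ)

/-- The constant `L(α, β) = ∫_{β^{-1/α}}^∞ u / (1 + u^α) du`. -/
def interferenceIntegral (α β : ℝ) : ℝ :=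
  ∫ u in Ioi (β ^ (-(1 / α))), u / (1 + u ^ α)

/-- The probability integral (Gauss error function) `Φ(x) = (2 / √π) ∫_0^x e^{-t²} dt`. -/
def probabilityIntegral (x : ℝ) : ℝ :=
  2 / Real.sqrt Real.pi * ∫ t in (0 : ℝ)..x, Real.exp (-t ^ 2)

end CellularD2D

end

/-! Write `r` for the distance to the nearest station. Given `r`, association has probability `q(r)
= exp(-γ r^α / (kP))`, the tail of an exponential gain. Since the inner probability is conditioned
on the distance alone, disintegrating the law of `(r, SINR)` gives `𝒫 · C_c = E[q(r) 1{SINR ≥ β}]`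
(`coverageProb_eq_toReal_lintegral`).

With the locations frozen, `SINR ≥ β` says `h_c ≥ t + ∑ a_i h_i` with `t = β σ² r^α / P` and `a_i =
β (r / r_i)^α`. Exponential tails and Laplace transforms turn its probability into `e^{-t} ∏ (1 +
a_i)⁻¹` (`IsRayleighFading.measure_tsum_le`). There remains a product over all points but the
nearest, jointly with `r`.

That joint law comes from the Laplace functional for functions with values in `[0, ∞]`. Giving the
function the value `∞` on a ball of radius `s` inserts the event `r > s`, so the functional yields
the tails of `r` under the weight `e^{-f(r)} ∏ e^{-f(r_i)}`. Differentiating the tails gives a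
density, and dividing by `e^{-f(r)}` removes the nearest point (`lintegral_nearestDist_mul`). Here
`f` also depends on `r`; approximating that dependence by step functions settles the diagonal case
(`lintegral_nearestDist_mul_diag`).

The exponent is a radial integral, which scaling reduces to `L(α, β)`. For `α = 4`, `L` is an
arctangent and the integral over `r` becomes Gaussian after completing the square in `r²`. -/

noncomputable section

namespace CellularD2D

open Filter Topology

/-! ### The function `x ↦ e^{-x}` on `[0, ∞]` -/

/-- The decreasing exponential `x ↦ e^{-x}` on `[0, ∞]`, with `e^{-∞} = 0`. -/
def expNeg (x : ENNReal) : ENNReal := EReal.exp (-(x : EReal))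

lemma expNeg_eq_inv (x : ENNReal) : expNeg x = (EReal.exp x)⁻¹ := EReal.exp_neg _

@[simp] lemma expNeg_zero : expNeg 0 = 1 := by simp [expNeg]

@[simp] lemma expNeg_top : expNeg ⊤ = 0 := by simp [expNeg]

lemma expNeg_ofReal {t : ℝ} (ht : 0 ≤ t) :
    expNeg (ENNReal.ofReal t) = ENNReal.ofReal (Real.exp (-t)) := by
  rw [expNeg, EReal.coe_ennreal_ofReal, max_eq_left ht, ← EReal.coe_neg, EReal.exp_coe]

lemma expNeg_add (x y : ENNReal) : expNeg (x + y) = expNeg x * expNeg y := by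
  rw [expNeg_eq_inv, expNeg_eq_inv, expNeg_eq_inv, EReal.coe_ennreal_add, EReal.exp_add]
  refine ENNReal.mul_inv (Or.inl ?_) (Or.inr ?_) <;>
    simp [EReal.exp_eq_zero_iff, EReal.coe_ennreal_ne_bot]

lemma expNeg_antitone : Antitone expNeg := fun x y hxy => by
  simpa [expNeg] using hxy

lemma expNeg_le_one (x : ENNReal) : expNeg x ≤ 1 := by
  simpa using expNeg_antitone (zero_le : 0 ≤ x)

lemma expNeg_ne_top (x : ENNReal) : expNeg x ≠ ⊤ :=
  ne_top_of_le_ne_top ENNReal.one_ne_top (expNeg_le_one x)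

lemma continuous_expNeg : Continuous expNeg :=
  ENNReal.continuous_exp.comp (continuous_neg.comp continuous_coe_ennreal_ereal)

@[fun_prop] lemma measurable_expNeg : Measurable expNeg := continuous_expNeg.measurable

lemma expNeg_sum {ι : Type*} (s : Finset ι) (f : ι → ENNReal) :
    expNeg (∑ i ∈ s, f i) = ∏ i ∈ s, expNeg (f i) := by
  classical
  induction s using Finset.induction_on with
  | empty => simp
  | insert a s ha ih => rw [Finset.sum_insert ha, Finset.prod_insert ha, expNeg_add, ih]

lemma expNeg_mul_natCast (c : ENNReal) (n : ℕ) : expNeg (c * n) = expNeg c ^ n := by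
  induction n with
  | zero => simp
  | succ n ih => rw [Nat.cast_succ, mul_add, mul_one, expNeg_add, ih, pow_succ]

/-- `(1 + a)⁻¹` is the Laplace transform of the mean-one exponential law at `a`. Writing it as
`e^{-log (1 + a)}` turns products over interferers into sums to which the Laplace functional
applies. -/
lemma expNeg_ofReal_log {a : ℝ} (ha : 0 ≤ a) :
    expNeg (ENNReal.ofReal (Real.log (1 + a))) = ENNReal.ofReal (1 + a)⁻¹ := by
  rw [expNeg_ofReal (Real.log_nonneg (by linarith)), Real.exp_neg, Real.exp_log (by linarith)]

/-! ### The Laplace functional of a Poisson point process -/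

/-- The Laplace transform of the Poisson law. -/
lemma lintegral_expNeg_poissonMeasure (m : NNReal) (c : ENNReal) :
    ∫⁻ n : ℕ, expNeg (c * n) ∂(poissonMeasure m) = expNeg (m * (1 - expNeg c)) := by
  obtain ⟨q, hq⟩ : ∃ q : NNReal, expNeg c = q := ⟨(expNeg c).toNNReal, by
    rw [ENNReal.coe_toNNReal (expNeg_ne_top c)]⟩
  have hq1 : q ≤ 1 := by
    have := expNeg_le_one c
    rw [hq] at this
    exact_mod_cast this
  have hs : HasSum (fun n : ℕ => Real.exp (-m) * ((m * q : ℝ) ^ n / n.factorial))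
      (Real.exp (-m) * Real.exp (m * q)) := by
    have := NormedSpace.expSeries_div_hasSum_exp (𝔸 := ℝ) ((m : ℝ) * q)
    rw [← Real.exp_eq_exp_ℝ] at this
    exact this.mul_left _
  rw [lintegral_countable']
  have hterm : ∀ n : ℕ, expNeg (c * n) * (poissonMeasure m) {n}
      = ENNReal.ofReal (Real.exp (-m) * ((m * q : ℝ) ^ n / n.factorial)) := fun n => by
    rw [expNeg_mul_natCast, hq, poissonMeasure_singleton, ← ENNReal.ofReal_coe_nnreal (p := q),
      ← ENNReal.ofReal_pow q.coe_nonneg, ← ENNReal.ofReal_mul (by positivity)]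
    congr 1
    rw [mul_pow]
    ring
  simp_rw [hterm]
  rw [← ENNReal.ofReal_tsum_of_nonneg (fun n => by positivity) hs.summable, hs.tsum_eq, hq]
  have hsub : (m : ENNReal) * (1 - (q : ENNReal)) = ENNReal.ofReal ((m : ℝ) * (1 - q)) := by
    rw [ENNReal.ofReal_mul m.coe_nonneg, ENNReal.ofReal_coe_nnreal,
      ENNReal.ofReal_sub _ q.coe_nonneg, ENNReal.ofReal_one, ENNReal.ofReal_coe_nnreal]
  have hq1' : (q : ℝ) ≤ 1 := by exact_mod_cast hq1
  rw [hsub, expNeg_ofReal (mul_nonneg m.coe_nonneg (by linarith)), ← Real.exp_add]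
  congr 2
  ring

section LaplaceFunctional

variable {Ω : Type*}

/-- The random counting measure of the points `b 0, b 1, …`. -/
def pointMeasure (b : ℕ → Ω → Plane) (ω : Ω) : Measure Plane :=
  Measure.sum fun i => Measure.dirac (b i ω)

lemma pointMeasure_apply (b : ℕ → Ω → Plane) (ω : Ω) {B : Set Plane} (hB : MeasurableSet B) :
    pointMeasure b ω B = (pointCount b B ω : ENNReal) := by
  rw [pointMeasure, Measure.sum_apply _ hB, pointCount, ← ENNReal.tsum_set_one,
    tsum_subtype {i : ℕ | b i ω ∈ B} (fun _ => (1 : ENNReal))]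
  refine tsum_congr fun i => ?_
  rw [Measure.dirac_apply' _ hB]
  simp [indicator]

lemma lintegral_pointMeasure (b : ℕ → Ω → Plane) (ω : Ω) {f : Plane → ENNReal}
    (hf : Measurable f) : ∫⁻ x, f x ∂(pointMeasure b ω) = ∑' i, f (b i ω) := by
  rw [pointMeasure, lintegral_sum_measure]
  simp_rw [lintegral_dirac' _ hf]

variable [MeasurableSpace Ω] {μ : Measure Ω} {lam : ℝ} {b : ℕ → Ω → Plane}

/-- The alternative `c = 0` covers the zero level set of a simple function, which may have infinite
area; both sides are then `1`, because `0 * ∞ = 0`. -/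
lemma IsPoissonPointProcess.lintegral_expNeg_mul_pointCount (hb : IsPoissonPointProcess μ lam b)
    [IsProbabilityMeasure μ] {B : Set Plane} (hB : MeasurableSet B) (c : ENNReal)
    (hc : c = 0 ∨ volume B ≠ ⊤) :
    ∫⁻ ω, expNeg (c * (pointCount b B ω : ENNReal)) ∂μ
      = expNeg (ENNReal.ofReal lam * ((1 - expNeg c) * volume B)) := by
  by_cases hc0 : c = 0
  · simp [hc0]
  have hfin := hc.resolve_left hc0
  rw [(hb.poisson B hB hfin).lintegral_comp
    (f := fun n : ℕ∞ => expNeg (c * (n : ENNReal))) (measurable_of_countable _).aemeasurable,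
    lintegral_map (measurable_of_countable _) (measurable_of_countable _)]
  simp only [ENat.toENNReal_coe]
  rw [lintegral_expNeg_poissonMeasure]
  congr 1
  have : ((lam * volume.real B).toNNReal : ENNReal) = ENNReal.ofReal lam * volume B := by
    change ENNReal.ofReal _ = _
    rw [ENNReal.ofReal_mul' measureReal_nonneg, ofReal_measureReal hfin]
  rw [this]
  ring

/-- The Laplace functional of a Poisson point process at a simple function. -/
lemma IsPoissonPointProcess.lintegral_expNeg_simpleFunc (hb : IsPoissonPointProcess μ lam b)
    [IsProbabilityMeasure μ] (φ : SimpleFunc Plane ENNReal)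
    (hφ : ∀ c, c ≠ 0 → volume (φ ⁻¹' {c}) ≠ ⊤) :
    ∫⁻ ω, expNeg (∑' i, φ (b i ω)) ∂μ
      = expNeg (ENNReal.ofReal lam * ∫⁻ x, (1 - expNeg (φ x))) := by
  -- Independence of counts is given for families indexed by `Fin m`, so the values of `φ` are
  -- numbered.
  let e := φ.range.equivFin
  have hsum : ∀ (g : ENNReal → ENNReal) (F : ENNReal → ENNReal),
      ∑ c ∈ φ.range, g c * F c = ∑ j, g (e.symm j) * F (e.symm j) := fun g F => by
    rw [← Finset.sum_coe_sort φ.range, ← e.symm.sum_comp]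
  have hmeas : ∀ j, MeasurableSet (φ ⁻¹' {(e.symm j : ENNReal)}) := fun j =>
    φ.measurableSet_preimage _
  have hind := hb.indep _ (fun j => φ ⁻¹' {(e.symm j : ENNReal)}) hmeas (by
    intro i j hij
    refine Disjoint.preimage _ (disjoint_singleton.2 fun hc => hij ?_)
    exact e.symm.injective (Subtype.ext hc))
  have hind' := hind.comp (fun j n => expNeg ((e.symm j : ENNReal) * (n : ENNReal)))
    (fun j => measurable_of_countable _)
  have hpc : ∀ j, Measurable (pointCount b (φ ⁻¹' {(e.symm j : ENNReal)})) := fun j => by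
    have h1 : Measurable fun ω =>
        ((pointCount b (φ ⁻¹' {(e.symm j : ENNReal)}) ω : ℕ∞) : ENNReal) := by
      simp_rw [← pointMeasure_apply b _ (hmeas j), pointMeasure, Measure.sum_apply _ (hmeas j),
        Measure.dirac_apply' _ (hmeas j)]
      refine Measurable.tsum fun i => ?_
      exact (measurable_one.indicator (hmeas j)).comp (hb.measurable i)
    refine measurable_to_countable' fun n => ?_
    have : pointCount b (φ ⁻¹' {(e.symm j : ENNReal)}) ⁻¹' {n} = (fun ω =>
      ((pointCount b (φ ⁻¹' {(e.symm j : ENNReal)}) ω : ℕ∞) : ENNReal)) ⁻¹' {(n : ENNReal)} := by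
      ext ω; simp
    rw [this]
    exact h1 (measurableSet_singleton _)
  -- The sum over the points is the integral of `φ` against the counting measure, hence a finite
  -- combination of counts of disjoint level sets.
  have hlhs : ∀ ω, expNeg (∑' i, φ (b i ω)) = ∏ j, (fun n : ℕ∞ =>
      expNeg ((e.symm j : ENNReal) * (n : ENNReal)))
        (pointCount b (φ ⁻¹' {(e.symm j : ENNReal)}) ω) := fun ω => by
    rw [← lintegral_pointMeasure b ω φ.measurable, SimpleFunc.lintegral_eq_lintegral,
      SimpleFunc.lintegral, hsum (fun c => c) (fun c => pointMeasure b ω (φ ⁻¹' {c})), expNeg_sum]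
    refine Finset.prod_congr rfl fun j _ => ?_
    rw [pointMeasure_apply b ω (hmeas j)]
  have hrhs : ∫⁻ x, (1 - expNeg (φ x))
      = ∑ j, (1 - expNeg (e.symm j)) * volume (φ ⁻¹' {(e.symm j : ENNReal)}) := by
    rw [← hsum (fun c => 1 - expNeg c) (fun c => volume (φ ⁻¹' {c})), ← SimpleFunc.map_lintegral,
      ← SimpleFunc.lintegral_eq_lintegral]
    rfl
  simp_rw [hlhs]
  rw [hrhs, Finset.mul_sum, expNeg_sum]
  refine (lintegral_prod_eq_prod_lintegral_of_indepFun Finset.univ _ hind' fun j =>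
    (measurable_of_countable _).comp (hpc j)).trans ?_
  refine Finset.prod_congr rfl fun j _ => ?_
  refine hb.lintegral_expNeg_mul_pointCount (hmeas j) _ ?_
  by_cases h0 : (e.symm j : ENNReal) = 0
  · exact Or.inl h0
  · exact Or.inr (hφ _ h0)

/-- The Laplace functional of a homogeneous Poisson point process. -/
theorem IsPoissonPointProcess.laplaceFunctional (hb : IsPoissonPointProcess μ lam b)
    [IsProbabilityMeasure μ] {f : Plane → ENNReal} (hf : Measurable f) :
    ∫⁻ ω, expNeg (∑' i, f (b i ω)) ∂μ
      = expNeg (ENNReal.ofReal lam * ∫⁻ x, (1 - expNeg (f x))) := by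
  -- Cutting off to balls gives every nonzero level set finite area, as the simple case requires.
  let φ : ℕ → SimpleFunc Plane ENNReal := fun n =>
    (SimpleFunc.eapprox f n).restrict (Metric.closedBall 0 (n : ℝ))
  have hφ : ∀ n x, φ n x = (Metric.closedBall (0 : Plane) (n : ℝ)).indicator
      (SimpleFunc.eapprox f n) x := fun n x =>
    SimpleFunc.restrict_apply _ measurableSet_closedBall x
  have hmono : ∀ x, Monotone fun n => φ n x := fun x n m hnm => by
    simp only [hφ]
    refine (indicator_le_indicator_of_subset (Metric.closedBall_subset_closedBall (by
      exact_mod_cast hnm)) (fun _ => zero_le) x).trans (indicator_le_indicator ?_)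
    exact SimpleFunc.monotone_eapprox f hnm x
  have htend : ∀ x, Tendsto (fun n => φ n x) atTop (𝓝 (f x)) := fun x => by
    refine (SimpleFunc.tendsto_eapprox hf x).congr' ?_
    obtain ⟨N, hN⟩ := exists_nat_ge ‖x‖
    filter_upwards [eventually_ge_atTop N] with n hn
    rw [hφ, indicator_of_mem]
    rw [mem_closedBall_zero_iff]
    exact hN.trans (by exact_mod_cast hn)
  have hsimple : ∀ n, ∫⁻ ω, expNeg (∑' i, φ n (b i ω)) ∂μ
      = expNeg (ENNReal.ofReal lam * ∫⁻ x, (1 - expNeg (φ n x))) := fun n => by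
    refine hb.lintegral_expNeg_simpleFunc (φ n) fun c hc => ?_
    refine ne_top_of_le_ne_top (measure_closedBall_lt_top (x := (0 : Plane)) (r := n)).ne
      (measure_mono fun x hx => ?_)
    by_contra hx'
    refine hc ?_
    rw [mem_preimage, hφ, indicator_of_notMem hx'] at hx
    exact hx.symm
  have hleft : Tendsto (fun n => ∫⁻ ω, expNeg (∑' i, φ n (b i ω)) ∂μ) atTop
      (𝓝 (∫⁻ ω, expNeg (∑' i, f (b i ω)) ∂μ)) := by
    refine tendsto_lintegral_of_dominated_convergence (fun _ => 1) (fun n => ?_)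
      (fun n => ae_of_all _ fun ω => expNeg_le_one _) (by simp) (ae_of_all _ fun ω => ?_)
    · exact measurable_expNeg.comp
        (Measurable.tsum fun i => (φ n).measurable.comp (hb.measurable i))
    · refine (continuous_expNeg.tendsto _).comp ?_
      simp_rw [← lintegral_pointMeasure b ω hf, ← lintegral_pointMeasure b ω (φ _).measurable]
      exact lintegral_tendsto_of_tendsto_of_monotone (fun n => (φ n).measurable.aemeasurable)
        (ae_of_all _ hmono) (ae_of_all _ htend)
  have hright : Tendsto (fun n => expNeg (ENNReal.ofReal lam * ∫⁻ x, (1 - expNeg (φ n x)))) atTop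
      (𝓝 (expNeg (ENNReal.ofReal lam * ∫⁻ x, (1 - expNeg (f x))))) := by
    refine (continuous_expNeg.tendsto _).comp (ENNReal.Tendsto.const_mul ?_
      (Or.inr ENNReal.ofReal_ne_top))
    refine lintegral_tendsto_of_tendsto_of_monotone (fun n => ?_) (ae_of_all _ ?_)
      (ae_of_all _ ?_)
    · exact (measurable_const.sub (measurable_expNeg.comp (φ n).measurable)).aemeasurable
    · exact fun x n m hnm => tsub_le_tsub_left (expNeg_antitone (hmono x hnm)) _
    · exact fun x => ENNReal.Tendsto.sub tendsto_const_nhds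
        ((continuous_expNeg.tendsto _).comp (htend x)) (Or.inl ENNReal.one_ne_top)
  exact tendsto_nhds_unique (hleft.congr hsimple) hright

end LaplaceFunctional

/-! ### The nearest base station -/

section Nearest

variable {Ω : Type*}

lemma tsum_ne_nearestIdx (b : ℕ → Ω → Plane) (u : Plane) (ω : Ω) (f : ℕ → ENNReal) :
    ∑' i : {i : ℕ // i ≠ nearestIdx b u ω}, f i
      = ∑' i, if i = nearestIdx b u ω then 0 else f i := by
  refine (tsum_subtype {i : ℕ | i ≠ nearestIdx b u ω} f).trans (tsum_congr fun i => ?_)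
  by_cases hi : i = nearestIdx b u ω <;> simp [indicator, hi]

variable [MeasurableSpace Ω] {μ : Measure Ω} {lam : ℝ} {b : ℕ → Ω → Plane}

lemma measurable_nearestIdx (hb : ∀ i, Measurable (b i)) (u : Plane) :
    Measurable (nearestIdx b u) := by
  have hS : ∀ i, MeasurableSet {ω | ∀ j, dist u (b i ω) ≤ dist u (b j ω)} := fun i => by
    rw [ofPred_forall]
    exact MeasurableSet.iInter fun j =>
      measurableSet_le (measurable_const.dist (hb i)) (measurable_const.dist (hb j))
  have hlt : ∀ n, MeasurableSet {ω | n < nearestIdx b u ω} := fun n => by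
    -- Since `sInf ∅ = 0`, the index exceeds `n` only if a minimizer exists and none is among `0, …,
    -- n`.
    have : {ω | n < nearestIdx b u ω} = (⋃ i, {ω | ∀ j, dist u (b i ω) ≤ dist u (b j ω)}) ∩
        ⋂ i : {i // i ≤ n}, {ω | ∀ j, dist u (b i ω) ≤ dist u (b j ω)}ᶜ := by
      ext ω
      simp only [mem_ofPred_eq, mem_inter_iff, mem_iUnion, mem_iInter, mem_compl_iff]
      constructor
      · intro h
        refine ⟨?_, fun i hi => ?_⟩
        · exact Nat.nonempty_of_pos_sInf (lt_of_le_of_lt (Nat.zero_le _) h)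
        · exact absurd (Nat.sInf_le (mem_ofPred_eq ▸ hi)) (not_le.2 (lt_of_le_of_lt i.2 h))
      · rintro ⟨hne, h⟩
        by_contra hn
        exact h ⟨_, not_lt.1 hn⟩ (Nat.sInf_mem hne)
    rw [this]
    exact (MeasurableSet.iUnion hS).inter (MeasurableSet.iInter fun i => (hS i).compl)
  exact measurable_of_Ioi hlt

lemma measurable_eval_nearestIdx {β : Type*} [MeasurableSpace β] (hb : ∀ i, Measurable (b i))
    (u : Plane) {f : ℕ → Ω → β} (hf : ∀ i, Measurable (f i)) :
    Measurable fun ω => f (nearestIdx b u ω) ω :=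
  (measurable_from_prod_countable_right (f := fun p : ℕ × Ω => f p.1 p.2) hf).comp
    ((measurable_nearestIdx hb u).prodMk measurable_id)

lemma measurable_nearestDist (hb : ∀ i, Measurable (b i)) (u : Plane) :
    Measurable (nearestDist b u) :=
  measurable_eval_nearestIdx hb u (f := fun i ω => dist u (b i ω))
    fun i => measurable_const.dist (hb i)

lemma measurable_tsum_ne_nearestIdx (hb : ∀ i, Measurable (b i)) (u : Plane)
    {f : ℕ → Ω → ENNReal} (hf : ∀ i, Measurable (f i)) :
    Measurable fun ω => ∑' i : {i : ℕ // i ≠ nearestIdx b u ω}, f i ω := by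
  have : (fun ω => ∑' i : {i : ℕ // i ≠ nearestIdx b u ω}, f i ω)
      = fun ω => ∑' i, if i = nearestIdx b u ω then 0 else f i ω :=
    funext fun ω => tsum_ne_nearestIdx b u ω fun i => f i ω
  rw [this]
  refine Measurable.tsum fun i => Measurable.ite ?_ measurable_const (hf i)
  exact measurableSet_eq_fun measurable_const (measurable_nearestIdx hb u)

/-- Almost surely every ball contains finitely many points, so the minimum is attained and
`nearestIdx` is not the default value of `sInf ∅`. -/
lemma IsPoissonPointProcess.ae_nearestDist_le (hb : IsPoissonPointProcess μ lam b) (u : Plane) :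
    ∀ᵐ ω ∂μ, ∀ j, nearestDist b u ω ≤ dist u (b j ω) := by
  have hfin : ∀ᵐ ω ∂μ, ∀ n : ℕ, pointCount b (Metric.closedBall u n) ω ≠ ⊤ := by
    rw [ae_all_iff]
    intro n
    have hlaw := hb.poisson (Metric.closedBall u n) measurableSet_closedBall
      measure_closedBall_lt_top.ne
    rw [hlaw.ae_iff (p := fun m => m ≠ ⊤) (measurable_of_countable _),
      ae_map_iff (measurable_of_countable _).aemeasurable (Set.to_countable _).measurableSet]
    exact ae_of_all _ fun m => ENat.natCast_ne_top m
  filter_upwards [hfin] with ω hω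
  -- A ball containing `b 0` is nonempty, and points outside it are farther than those inside, so a
  -- minimizer within it is global.
  obtain ⟨n, hn⟩ := exists_nat_ge (dist u (b 0 ω))
  have hF : {i | b i ω ∈ Metric.closedBall u n}.Finite := by
    rw [← encard_ne_top_iff]
    exact hω n
  obtain ⟨i, hi, hmin⟩ := exists_min_image _ (fun i => dist u (b i ω)) hF
    ⟨0, by rwa [mem_ofPred_eq, Metric.mem_closedBall']⟩
  have hne : {i : ℕ | ∀ j : ℕ, dist u (b i ω) ≤ dist u (b j ω)}.Nonempty := by
    refine ⟨i, fun j => ?_⟩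
    by_cases hj : b j ω ∈ Metric.closedBall u n
    · exact hmin j hj
    · rw [Metric.mem_closedBall', not_le] at hj
      rw [mem_ofPred_eq, Metric.mem_closedBall'] at hi
      exact hi.trans hj.le
  exact Nat.sInf_mem hne

/-- A singleton has zero area, so its count is Poisson of mean `0`. Distance zero must be excluded
because the powers of the distance are controlled only on `(0, ∞)`. -/
lemma IsPoissonPointProcess.ae_nearestDist_pos (hb : IsPoissonPointProcess μ lam b)
    [IsProbabilityMeasure μ] (u : Plane) : ∀ᵐ ω ∂μ, 0 < nearestDist b u ω := by
  have hlaw := hb.poisson {u} (measurableSet_singleton u) (by simp)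
  have h0 : ∀ᵐ ω ∂μ, pointCount b {u} ω = 0 := by
    rw [hlaw.ae_iff (p := fun m => m = 0) (measurable_of_countable _),
      ae_map_iff (measurable_of_countable _).aemeasurable (Set.to_countable _).measurableSet,
      ae_iff_of_countable]
    intro m hm
    by_contra hm0
    refine hm ?_
    have hm0' : m ≠ 0 := by simpa using hm0
    have hvol : volume.real {u} = 0 := by simp [measureReal_def]
    rw [poissonMeasure_singleton, hvol]
    simp [hm0']
  filter_upwards [h0] with ω hω
  rw [pointCount, encard_eq_zero] at hω
  refine dist_pos.2 fun h => ?_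
  have : nearestIdx b u ω ∈ {i | b i ω ∈ ({u} : Set Plane)} := h.symm
  rw [hω] at this
  exact this

/-- The sum of `f` over the distances to all base stations other than the nearest one. -/
def otherSum (b : ℕ → Ω → Plane) (u : Plane) (f : ℝ → ENNReal) (ω : Ω) : ENNReal :=
  ∑' i : {i : ℕ // i ≠ nearestIdx b u ω}, f (dist u (b i ω))

/-- The exponent of the Laplace functional at `x ↦ f (dist u x)`, with the points in the closed ball
of radius `r` excluded. -/
def exteriorExponent (lam : ℝ) (u : Plane) (f : ℝ → ENNReal) (r : ℝ) : ENNReal :=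
  ENNReal.ofReal lam * ∫⁻ x, (1 - expNeg (if dist u x ≤ r then ⊤ else f (dist u x)))

lemma measurable_otherSum (hb : ∀ i, Measurable (b i)) (u : Plane) {f : ℝ → ENNReal}
    (hf : Measurable f) : Measurable (otherSum b u f) :=
  measurable_tsum_ne_nearestIdx hb u (f := fun i ω => f (dist u (b i ω)))
    fun i => hf.comp (measurable_const.dist (hb i))

/-- One point in the ball, where the function is `∞`, makes the whole sum infinite and its
exponential zero. The Laplace functional thus carries the indicator of an empty ball; off that event
the sum splits into the nearest term and the rest. -/
lemma IsPoissonPointProcess.lintegral_nearestDist_gt (hb : IsPoissonPointProcess μ lam b)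
    [IsProbabilityMeasure μ] (u : Plane) {f : ℝ → ENNReal} (hf : Measurable f) (r : ℝ) :
    ∫⁻ ω, (Ioi r).indicator 1 (nearestDist b u ω) *
      (expNeg (f (nearestDist b u ω)) * expNeg (otherSum b u f ω)) ∂μ
      = expNeg (exteriorExponent lam u f r) := by
  have hg : Measurable fun x : Plane => if dist u x ≤ r then ⊤ else f (dist u x) :=
    Measurable.ite (measurableSet_le (measurable_const.dist measurable_id) measurable_const)
      measurable_const (hf.comp (measurable_const.dist measurable_id))
  rw [exteriorExponent, ← hb.laplaceFunctional hg]
  refine lintegral_congr_ae ?_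
  filter_upwards [hb.ae_nearestDist_le u] with ω hω
  by_cases hr : nearestDist b u ω ≤ r
  · have : ∑' i, (if dist u (b i ω) ≤ r then (⊤ : ENNReal) else f (dist u (b i ω))) = ⊤ :=
      ENNReal.tsum_eq_top_of_eq_top ⟨nearestIdx b u ω, if_pos hr⟩
    simp [this, hr]
  · have h1 : ∀ i, ¬ dist u (b i ω) ≤ r := fun i hi => hr ((hω i).trans hi)
    simp only [h1, if_false]
    rw [ENNReal.tsum_eq_add_tsum_ite (nearestIdx b u ω), expNeg_add, otherSum,
      tsum_ne_nearestIdx b u ω fun i => f (dist u (b i ω)), indicator_of_mem (mem_Ioi.2 (not_le.1 hr))]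
    simp [nearestDist]
    congr!

end Nearest

/-! ### Radial integrals -/

lemma integral_radial (u : Plane) (g : ℝ → ℝ) :
    ∫ x : Plane, g (dist u x) = 2 * Real.pi * ∫ y in Ioi (0 : ℝ), y * g y := by
  have h1 : ∫ x : Plane, g (dist u x) = ∫ x : Plane, g ‖x‖ := by
    simp_rw [dist_comm u, dist_eq_norm]
    exact integral_sub_right_eq_self (fun x => g ‖x‖) u
  rw [h1, integral_fun_norm_addHaar, finrank_euclideanSpace, Fintype.card_fin, measureReal_def,
    EuclideanSpace.volume_ball_fin_two]
  simp [Real.pi_pos.le, mul_assoc]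

lemma integrable_radial (u : Plane) {g : ℝ → ℝ} (hg : IntegrableOn (fun y => y * g y) (Ioi 0)) :
    Integrable fun x : Plane => g (dist u x) := by
  have h1 : Integrable fun x : Plane => g ‖x‖ := by
    rw [integrable_fun_norm_addHaar, finrank_euclideanSpace, Fintype.card_fin]
    simpa using hg
  have := h1.comp_sub_right u
  simpa only [dist_comm u, dist_eq_norm] using this

/-- The real form of `exteriorExponent` when `e^{-f} = w`. -/
def radialExponent (lam : ℝ) (w : ℝ → ℝ) (r : ℝ) : ℝ :=
  Real.pi * lam * r ^ 2 + 2 * Real.pi * lam * ∫ v in Ioi r, v * (1 - w v)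

lemma exteriorExponent_eq {lam : ℝ} (hlam : 0 < lam) (u : Plane) {f : ℝ → ENNReal} {w : ℝ → ℝ}
    (hw : ∀ v, 0 < v → 0 ≤ w v ∧ w v ≤ 1) (hfw : ∀ v, 0 < v → expNeg (f v) = ENNReal.ofReal (w v))
    (hint : IntegrableOn (fun v => v * (1 - w v)) (Ioi 0)) {r : ℝ} (hr : 0 ≤ r) :
    exteriorExponent lam u f r = ENNReal.ofReal (radialExponent lam w r) := by
  -- On the excluded ball `1 - e^{-∞} = 1`, which produces the area term `π r²`.
  let g : ℝ → ℝ := fun v => if v ≤ r then 1 else 1 - w v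
  have hg0 : ∀ v, 0 ≤ v → 0 ≤ g v := fun v hv => by
    by_cases hvr : v ≤ r
    · simp [g, hvr]
    · simp only [g, hvr, if_false]
      linarith [(hw v (hr.trans_lt (not_le.1 hvr))).2]
  have hpt : ∀ x : Plane, 1 - expNeg (if dist u x ≤ r then ⊤ else f (dist u x))
      = ENNReal.ofReal (g (dist u x)) := fun x => by
    by_cases hx : dist u x ≤ r
    · simp [g, hx]
    · have hpos := hr.trans_lt (not_le.1 hx)
      simp only [g, hx, if_false]
      rw [hfw _ hpos, ENNReal.ofReal_sub _ (hw _ hpos).1, ENNReal.ofReal_one]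
  have hIoc : IntegrableOn (fun y => y * g y) (Ioc 0 r) := by
    refine (continuous_id.integrableOn_Ioc (a := 0) (b := r) (μ := volume)).congr_fun ?_
      measurableSet_Ioc
    intro y hy
    simp [g, hy.2]
  have hIoi : IntegrableOn (fun y => y * g y) (Ioi r) := by
    refine (hint.mono_set (Ioi_subset_Ioi hr)).congr_fun ?_ measurableSet_Ioi
    intro y hy
    simp [g, not_le.2 (mem_Ioi.1 hy)]
  have hgi : IntegrableOn (fun y => y * g y) (Ioi 0) := by
    rw [← Ioc_union_Ioi_eq_Ioi hr]
    exact hIoc.union hIoi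
  rw [exteriorExponent]
  simp_rw [hpt]
  rw [← ofReal_integral_eq_lintegral_ofReal (integrable_radial u hgi)
    (ae_of_all _ fun x => hg0 _ dist_nonneg), ← ENNReal.ofReal_mul hlam.le, integral_radial,
    ← Ioc_union_Ioi_eq_Ioi hr, setIntegral_union (Ioc_disjoint_Ioi le_rfl) measurableSet_Ioi
      hIoc hIoi, radialExponent]
  have e1 : ∫ y in Ioc 0 r, y * g y = r ^ 2 / 2 := by
    have : ∫ y in Ioc 0 r, y * g y = ∫ y in Ioc 0 r, y :=
      setIntegral_congr_fun measurableSet_Ioc fun y hy => by simp [g, hy.2]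
    rw [this, ← intervalIntegral.integral_of_le hr, integral_id]
    ring
  have e2 : ∫ y in Ioi r, y * g y = ∫ y in Ioi r, y * (1 - w y) :=
    setIntegral_congr_fun measurableSet_Ioi fun y hy => by simp [g, not_le.2 (mem_Ioi.1 hy)]
  rw [e1, e2]
  congr 1
  ring

lemma integral_Ioi_nonneg_of_le_one {w : ℝ → ℝ} (hw : ∀ v, 0 < v → 0 < w v ∧ w v ≤ 1) {r : ℝ}
    (hr : 0 ≤ r) : 0 ≤ ∫ v in Ioi r, v * (1 - w v) :=
  setIntegral_nonneg measurableSet_Ioi fun v hv => by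
    have hv0 : 0 < v := hr.trans_lt hv
    exact mul_nonneg hv0.le (by linarith [(hw v hv0).2])

lemma radialExponent_ge {lam : ℝ} (hlam : 0 < lam) {w : ℝ → ℝ}
    (hw : ∀ v, 0 < v → 0 < w v ∧ w v ≤ 1) {r : ℝ} (hr : 0 ≤ r) :
    Real.pi * lam * r ^ 2 ≤ radialExponent lam w r := by
  have := integral_Ioi_nonneg_of_le_one hw hr
  have hpi := Real.pi_pos
  rw [radialExponent]
  have : 0 ≤ 2 * Real.pi * lam * ∫ v in Ioi r, v * (1 - w v) := by positivity
  linarith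

/-- The exponent has derivative `2πλs - 2πλs(1 - w s) = 2πλs w(s)`, so the integrand is the
derivative of `-e^{-exponent}`, which vanishes at infinity. -/
lemma lintegral_Ioi_radialExponent {lam : ℝ} (hlam : 0 < lam) {w : ℝ → ℝ}
    (hwc : ContinuousOn w (Ioi 0)) (hw : ∀ v, 0 < v → 0 < w v ∧ w v ≤ 1)
    (hint : IntegrableOn (fun v => v * (1 - w v)) (Ioi 0)) {r : ℝ} (hr : 0 ≤ r) :
    ∫⁻ s in Ioi r, ENNReal.ofReal (2 * Real.pi * lam * s * w s *
      Real.exp (-radialExponent lam w s)) = ENNReal.ofReal (Real.exp (-radialExponent lam w r)) := by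
  have hpi := Real.pi_pos
  let κ : ℝ → ℝ := (Ioi 0).indicator fun v => v * (1 - w v)
  have hκ : Integrable κ := (integrable_indicator_iff measurableSet_Ioi).2 hint
  -- The tail integral is written as the total minus a primitive; this form is continuous on the
  -- whole line and differentiable by the fundamental theorem of calculus.
  let G : ℝ → ℝ := fun s => Real.pi * lam * s ^ 2 +
    2 * Real.pi * lam * ((∫ v in Ioi 0, v * (1 - w v)) - ∫ v in (0 : ℝ)..s, κ v)
  have hG : ∀ s, 0 ≤ s → radialExponent lam w s = G s := fun s hs => by
    have h1 := intervalIntegral.integral_interval_add_Ioi (μ := volume)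
      (hκ.integrableOn (s := Ioi 0)) (hκ.integrableOn (s := Ioi s))
    have h2 : ∫ v in Ioi s, κ v = ∫ v in Ioi s, v * (1 - w v) :=
      setIntegral_congr_fun measurableSet_Ioi fun v hv =>
        indicator_of_mem (show v ∈ Ioi (0 : ℝ) from lt_of_le_of_lt hs hv) _
    have h3 : ∫ v in Ioi 0, κ v = ∫ v in Ioi 0, v * (1 - w v) :=
      setIntegral_congr_fun measurableSet_Ioi fun v hv => indicator_of_mem hv _
    simp only [G, radialExponent, ← h2, ← h3, ← h1]
    ring
  have hGc : Continuous G := by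
    have := intervalIntegral.continuous_primitive (f := κ) (μ := volume)
      (fun a b => hκ.intervalIntegrable) 0
    fun_prop
  have hGd : ∀ s, 0 < s → HasDerivAt G (2 * Real.pi * lam * s * w s) s := fun s hs => by
    have hc : ContinuousOn κ (Ioi 0) :=
      ContinuousOn.congr (continuousOn_id.mul (continuousOn_const.sub hwc))
        fun v hv => indicator_of_mem hv _
    have h1 := intervalIntegral.integral_hasDerivAt_right (f := κ) (a := 0) (b := s)
      hκ.intervalIntegrable (hc.stronglyMeasurableAtFilter isOpen_Ioi s hs)
      (hc.continuousAt (Ioi_mem_nhds hs))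
    have h2 := ((hasDerivAt_pow 2 s).const_mul (Real.pi * lam)).add
      ((h1.const_sub (∫ v in Ioi 0, v * (1 - w v))).const_mul (2 * Real.pi * lam))
    refine h2.congr_deriv ?_
    simp only [κ, indicator_of_mem (show s ∈ Ioi (0 : ℝ) from hs)]
    push_cast
    ring
  have hgc : ContinuousWithinAt (fun s => -Real.exp (-G s)) (Ici r) r :=
    (by fun_prop : Continuous fun s => -Real.exp (-G s)).continuousWithinAt
  have hgd : ∀ s ∈ Ioi r, HasDerivAt (fun s => -Real.exp (-G s))
      (2 * Real.pi * lam * s * w s * Real.exp (-G s)) s := fun s hs => by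
    refine (hGd s (hr.trans_lt hs)).neg.exp.neg.congr_deriv ?_
    rw [Pi.neg_apply]
    ring
  have hpos : ∀ s ∈ Ioi r, 0 ≤ 2 * Real.pi * lam * s * w s * Real.exp (-G s) := fun s hs => by
    have hs0 : 0 < s := hr.trans_lt hs
    have := (hw s hs0).1
    positivity
  have hlim : Tendsto (fun s => -Real.exp (-G s)) atTop (𝓝 0) := by
    rw [← neg_zero]
    refine (Real.tendsto_exp_neg_atTop_nhds_zero.comp ?_).neg
    refine tendsto_atTop_mono' _ ?_ ((tendsto_pow_atTop (α := ℝ) two_ne_zero).const_mul_atTop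
      (mul_pos hpi hlam))
    filter_upwards [eventually_ge_atTop 0] with s hs
    rw [← hG s hs]
    exact radialExponent_ge hlam hw hs
  have hval := integral_Ioi_of_hasDerivAt_of_nonneg hgc hgd hpos hlim
  have hintg := integrableOn_Ioi_deriv_of_nonneg hgc hgd hpos hlim
  rw [hG r hr, show Real.exp (-G r) = 0 - -Real.exp (-G r) by ring, ← hval,
    ofReal_integral_eq_lintegral_ofReal hintg
      ((ae_restrict_iff' measurableSet_Ioi).2 (ae_of_all _ hpos))]
  refine setLIntegral_congr_fun measurableSet_Ioi fun s hs => ?_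
  rw [hG s (hr.trans (mem_Ioi.1 hs).le)]

/-! ### The joint law of the nearest base station and the others -/

section NearestLaw

variable {Ω : Type*} [MeasurableSpace Ω] {μ : Measure Ω} {lam : ℝ} {b : ℕ → Ω → Plane}

/-- `e^{-f} = w` for a continuous `w` with values in `(0, 1]` such that `v (1 - w v)` is integrable:
the exponent of the Laplace functional at `x ↦ f (dist u x)` is then finite. -/
structure IsRadialLoss (f : ℝ → ENNReal) (w : ℝ → ℝ) : Prop where
  measurable : Measurable f
  continuousOn : ContinuousOn w (Ioi 0)
  mem_Ioc : ∀ v, 0 < v → 0 < w v ∧ w v ≤ 1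
  expNeg_eq : ∀ v, 0 < v → expNeg (f v) = ENNReal.ofReal (w v)
  integrableOn : IntegrableOn (fun v => v * (1 - w v)) (Ioi 0)

lemma measurable_exteriorExponent (lam : ℝ) (u : Plane) {f : ℝ → ENNReal} (hf : Measurable f) :
    Measurable (exteriorExponent lam u f) := by
  have hF : Measurable fun p : ℝ × Plane =>
      1 - expNeg (if dist u p.2 ≤ p.1 then ⊤ else f (dist u p.2)) := by
    have hd : Measurable fun p : ℝ × Plane => dist u p.2 :=
      measurable_const.dist measurable_snd
    exact measurable_const.sub (measurable_expNeg.comp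
      (Measurable.ite (measurableSet_le hd measurable_fst) measurable_const (hf.comp hd)))
  exact hF.lintegral_prod_right'.const_mul _

/-- The excluded ball alone contributes its area to the exponent. The bound does not involve `f`, so
it can serve as a dominating function. -/
lemma expNeg_exteriorExponent_le {lam : ℝ} (hlam : 0 < lam) (u : Plane) (f : ℝ → ENNReal) {r : ℝ}
    (hr : 0 ≤ r) :
    expNeg (exteriorExponent lam u f r) ≤ ENNReal.ofReal (Real.exp (-(Real.pi * lam * r ^ 2))) := by
  have hpi := Real.pi_pos
  rw [← expNeg_ofReal (by positivity)]
  refine expNeg_antitone ?_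
  have h1 : ENNReal.ofReal (Real.pi * lam * r ^ 2)
      = ENNReal.ofReal lam * volume (Metric.closedBall u r) := by
    rw [EuclideanSpace.volume_closedBall_fin_two, ← ENNReal.ofReal_pow hr,
      ← ENNReal.ofReal_mul (by positivity), ← ENNReal.ofReal_mul hlam.le]
    congr 1
    ring
  rw [h1, exteriorExponent, ← lintegral_indicator_one measurableSet_closedBall]
  gcongr with x
  by_cases hx : x ∈ Metric.closedBall u r
  · have hx' : dist u x ≤ r := Metric.mem_closedBall'.1 hx
    simp [hx, hx']
  · simp [hx]

/-- Under the weight `D`, which includes the nearest point, the tails of the nearest distance are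
Laplace functionals. They agree with the tails of the density `d`, and half-lines form a π-system,
so `ν₁ = ν₂`. Testing against `g / e^{-f}` then cancels the factor of the nearest point. -/
lemma IsPoissonPointProcess.lintegral_nearestDist_mul (hb : IsPoissonPointProcess μ lam b)
    [IsProbabilityMeasure μ] (hlam : 0 < lam) (u : Plane) {f : ℝ → ENNReal} {w : ℝ → ℝ}
    (hfw : IsRadialLoss f w) {g : ℝ → ENNReal} (hg : Measurable g) :
    ∫⁻ ω, g (nearestDist b u ω) * expNeg (otherSum b u f ω) ∂μ
      = ∫⁻ s in Ioi 0, g s *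
        (ENNReal.ofReal (2 * Real.pi * lam * s) * expNeg (exteriorExponent lam u f s)) := by
  have hpi := Real.pi_pos
  have hR := measurable_nearestDist hb.measurable u
  have hfm := measurable_expNeg.comp hfw.measurable
  have hJ : Measurable fun ω => expNeg (otherSum b u f ω) :=
    measurable_expNeg.comp (measurable_otherSum hb.measurable u hfw.measurable)
  have hE : Measurable fun s => expNeg (exteriorExponent lam u f s) :=
    measurable_expNeg.comp (measurable_exteriorExponent lam u hfw.measurable)
  let D : Ω → ENNReal := fun ω => expNeg (f (nearestDist b u ω)) * expNeg (otherSum b u f ω)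
  have hD : Measurable D := (hfm.comp hR).mul hJ
  let d : ℝ → ENNReal := fun s => ENNReal.ofReal (2 * Real.pi * lam * s) *
    (expNeg (f s) * expNeg (exteriorExponent lam u f s))
  have hd : Measurable d :=
    (measurable_id.const_mul _).ennreal_ofReal.mul (hfm.mul hE)
  let ν₁ : Measure ℝ := (μ.withDensity D).map (nearestDist b u)
  let ν₂ : Measure ℝ := (volume.restrict (Ioi 0)).withDensity d
  have hν₁ : ∀ r, ν₁ (Ioi r) = expNeg (exteriorExponent lam u f r) := fun r => by
    rw [← hb.lintegral_nearestDist_gt u hfw.measurable r, Measure.map_apply hR measurableSet_Ioi,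
      withDensity_apply _ (hR measurableSet_Ioi), ← lintegral_indicator (hR measurableSet_Ioi)]
    refine lintegral_congr fun ω => ?_
    by_cases hω : nearestDist b u ω ∈ Ioi r
    · rw [indicator_of_mem (show ω ∈ nearestDist b u ⁻¹' Ioi r from hω), indicator_of_mem hω]
      simp [D]
    · rw [indicator_of_notMem (show ω ∉ nearestDist b u ⁻¹' Ioi r from hω),
        indicator_of_notMem hω, zero_mul]
  have hν₁0 : ν₁ (Iic 0) = 0 := by
    rw [Measure.map_apply hR measurableSet_Iic]
    refine withDensity_absolutelyContinuous μ D ?_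
    have := hb.ae_nearestDist_pos u
    rw [ae_iff] at this
    refine measure_mono_null (fun ω hω => ?_) this
    exact not_lt.2 (mem_Iic.1 hω)
  have hν₂0 : ν₂ (Iic 0) = 0 := by
    rw [withDensity_apply _ measurableSet_Iic, Measure.restrict_restrict measurableSet_Iic,
      Iic_inter_Ioi, Ioc_self, Measure.restrict_empty, lintegral_zero_measure]
  have hν₂ : ∀ r, 0 ≤ r → ν₂ (Ioi r) = expNeg (exteriorExponent lam u f r) := fun r hr => by
    have hw' : ∀ v, 0 < v → 0 ≤ w v ∧ w v ≤ 1 := fun v hv =>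
      ⟨(hfw.mem_Ioc v hv).1.le, (hfw.mem_Ioc v hv).2⟩
    have hexp : ∀ s, 0 ≤ s → expNeg (exteriorExponent lam u f s)
        = ENNReal.ofReal (Real.exp (-radialExponent lam w s)) := fun s hs => by
      rw [exteriorExponent_eq hlam u hw' hfw.expNeg_eq hfw.integrableOn hs, expNeg_ofReal]
      exact (by positivity : 0 ≤ Real.pi * lam * s ^ 2).trans
        (radialExponent_ge hlam hfw.mem_Ioc hs)
    rw [hexp r hr, ← lintegral_Ioi_radialExponent hlam hfw.continuousOn hfw.mem_Ioc
      hfw.integrableOn hr, withDensity_apply _ measurableSet_Ioi,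
      Measure.restrict_restrict measurableSet_Ioi, Ioi_inter_Ioi, sup_eq_left.2 hr]
    refine setLIntegral_congr_fun measurableSet_Ioi fun s hs => ?_
    have hs0 : 0 < s := hr.trans_lt hs
    have hws := (hfw.mem_Ioc s hs0).1
    simp only [d]
    rw [hexp s hs0.le, hfw.expNeg_eq s hs0, ← ENNReal.ofReal_mul hws.le,
      ← ENNReal.ofReal_mul (by positivity)]
    congr 1
    ring
  -- The tail of `ν₂` is computed only for `r ≥ 0`; neither measure charges `(-∞, 0]`, which reduces
  -- negative `r` to `0`.
  have hsplit : ∀ (ν : Measure ℝ), ν (Iic 0) = 0 → ∀ r < 0, ν (Ioi r) = ν (Ioi 0) := by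
    intro ν hν r hr
    rw [← Ioc_union_Ioi_eq_Ioi hr.le]
    refine le_antisymm ((measure_union_le _ _).trans ?_) (measure_mono subset_union_right)
    rw [measure_mono_null Ioc_subset_Iic_self hν, zero_add]
  have huniv : ∀ (ν : Measure ℝ), ν (Iic 0) = 0 → ν univ = ν (Ioi 0) := by
    intro ν hν
    rw [← Iic_union_Ioi (a := (0 : ℝ))]
    refine le_antisymm ((measure_union_le _ _).trans ?_) (measure_mono subset_union_right)
    rw [hν, zero_add]
  have hfin : IsFiniteMeasure ν₁ := ⟨by
    rw [huniv ν₁ hν₁0, hν₁]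
    exact (expNeg_ne_top _).lt_top⟩
  have hν : ν₁ = ν₂ := by
    refine ext_of_generate_finite (range Ioi)
      ((BorelSpace.measurable_eq (α := ℝ)).trans (borel_eq_generateFrom_Ioi ℝ)) isPiSystem_Ioi ?_ ?_
    · rintro _ ⟨r, rfl⟩
      rcases lt_or_ge r 0 with hr | hr
      · rw [hsplit ν₁ hν₁0 r hr, hsplit ν₂ hν₂0 r hr, hν₁, hν₂ 0 le_rfl]
      · rw [hν₁, hν₂ r hr]
    · rw [huniv ν₁ hν₁0, huniv ν₂ hν₂0, hν₁, hν₂ 0 le_rfl]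
  have hgm : Measurable fun s => g s * (expNeg (f s))⁻¹ := hg.mul hfm.inv
  have hcancel : ∀ v, 0 < v → (expNeg (f v))⁻¹ * expNeg (f v) = 1 := fun v hv =>
    ENNReal.inv_mul_cancel (by
      rw [hfw.expNeg_eq v hv]
      exact (ENNReal.ofReal_pos.2 (hfw.mem_Ioc v hv).1).ne') (expNeg_ne_top _)
  have key : ∫⁻ s, g s * (expNeg (f s))⁻¹ ∂ν₁ = ∫⁻ s, g s * (expNeg (f s))⁻¹ ∂ν₂ := by rw [hν]
  rw [lintegral_map hgm hR, lintegral_withDensity_eq_lintegral_mul _ hD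
      (g := fun ω => g (nearestDist b u ω) * (expNeg (f (nearestDist b u ω)))⁻¹) (hgm.comp hR),
    lintegral_withDensity_eq_lintegral_mul _ hd hgm] at key
  calc ∫⁻ ω, g (nearestDist b u ω) * expNeg (otherSum b u f ω) ∂μ
      = _ := ?_
    _ = _ := key
    _ = _ := ?_
  · refine lintegral_congr_ae ?_
    filter_upwards [hb.ae_nearestDist_pos u] with ω hω
    simp only [Pi.mul_apply, D]
    rw [show ∀ a b c d : ENNReal, a * b * (c * d) = (d * a) * (c * b) by intros; ring,
      hcancel _ hω, one_mul]
  · refine setLIntegral_congr_fun measurableSet_Ioi fun s hs => ?_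
    simp only [Pi.mul_apply, d]
    rw [show ∀ a b c d e : ENNReal, a * (b * c) * (d * e) = (e * b) * (d * (a * c)) by
      intros; ring, hcancel s hs, one_mul]

/-- This freezes a parameter depending on the nearest distance to a constant on each level set. -/
lemma simpleFunc_comp_eq_sum {α γ : Type*} [MeasurableSpace α] (φ : SimpleFunc α γ)
    (H : γ → ENNReal) (x : α) :
    H (φ x) = ∑ c ∈ φ.range, (φ ⁻¹' {c}).indicator 1 x * H c := by
  classical
  rw [Finset.sum_eq_single (φ x)]
  · simp
  · intro c _ hc
    rw [indicator_of_notMem (fun h => hc h.symm), zero_mul]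
  · exact fun h => absurd (φ.mem_range_self x) h

/-- The joint law of the nearest distance and of the other points, for a loss function that depends
monotonically and continuously on the nearest distance. -/
theorem IsPoissonPointProcess.lintegral_nearestDist_mul_diag (hb : IsPoissonPointProcess μ lam b)
    [IsProbabilityMeasure μ] (hlam : 0 < lam) (u : Plane) {F : ℝ → ℝ → ENNReal} {W : ℝ → ℝ → ℝ}
    (hFW : ∀ ρ, 0 ≤ ρ → IsRadialLoss (F ρ) (W ρ))
    (hmono : ∀ v ρ ρ', 0 ≤ ρ → ρ ≤ ρ' → F ρ v ≤ F ρ' v)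
    (hcont : ∀ v, Continuous fun ρ => F ρ v)
    {g : ℝ → ENNReal} (hg : Measurable g) (hg1 : ∀ s, g s ≤ 1) :
    ∫⁻ ω, g (nearestDist b u ω) *
        expNeg (otherSum b u (F (nearestDist b u ω)) ω) ∂μ
      = ∫⁻ s in Ioi 0, g s * (ENNReal.ofReal (2 * Real.pi * lam * s) *
          expNeg (exteriorExponent lam u (F s) s)) := by
  have hpi := Real.pi_pos
  have hR := measurable_nearestDist hb.measurable u
  -- Nonnegative step functions of the distance increasing to it. The values of `eapprox` are
  -- finite, so `toReal` preserves their order.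
  let ρ : ℕ → SimpleFunc ℝ ℝ := fun n =>
    (SimpleFunc.eapprox ENNReal.ofReal n).map ENNReal.toReal
  have hρ0 : ∀ n s, 0 ≤ ρ n s := fun n s => ENNReal.toReal_nonneg
  have hρmono : ∀ s, Monotone fun n => ρ n s := fun s n m hnm =>
    ENNReal.toReal_mono (SimpleFunc.eapprox_lt_top _ _ _).ne
      (SimpleFunc.monotone_eapprox ENNReal.ofReal hnm s)
  have hρlim : ∀ s, 0 ≤ s → Tendsto (fun n => ρ n s) atTop (𝓝 s) := fun s hs => by
    have := (ENNReal.tendsto_toReal ENNReal.ofReal_ne_top).comp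
      (SimpleFunc.tendsto_eapprox ENNReal.measurable_ofReal s)
    rwa [ENNReal.toReal_ofReal hs] at this
  have hFm : ∀ n s, Measurable (F (ρ n s)) := fun n s => (hFW _ (hρ0 n s)).measurable
  have hrange : ∀ n, ∀ c ∈ (ρ n).range, 0 ≤ c := fun n c hc => by
    obtain ⟨s, rfl⟩ := SimpleFunc.mem_range.1 hc
    exact hρ0 n s
  have hstepL : ∀ n ω, g (nearestDist b u ω) *
      expNeg (otherSum b u (F (ρ n (nearestDist b u ω))) ω)
      = ∑ c ∈ (ρ n).range, (g (nearestDist b u ω) * (ρ n ⁻¹' {c}).indicator 1 (nearestDist b u ω))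
        * expNeg (otherSum b u (F c) ω) := fun n ω => by
    rw [simpleFunc_comp_eq_sum (ρ n) (fun c => expNeg (otherSum b u (F c) ω)), Finset.mul_sum]
    simp_rw [mul_assoc]
  have hstepR : ∀ n s, g s * (ENNReal.ofReal (2 * Real.pi * lam * s) *
      expNeg (exteriorExponent lam u (F (ρ n s)) s))
      = ∑ c ∈ (ρ n).range, (g s * (ρ n ⁻¹' {c}).indicator 1 s) *
        (ENNReal.ofReal (2 * Real.pi * lam * s) *
          expNeg (exteriorExponent lam u (F c) s)) := fun n s => by
    rw [simpleFunc_comp_eq_sum (ρ n) (fun c => expNeg (exteriorExponent lam u (F c) s)),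
      Finset.mul_sum, Finset.mul_sum]
    refine Finset.sum_congr rfl fun c _ => ?_
    ring
  have hgi : ∀ n c, Measurable fun s => g s * (ρ n ⁻¹' {c}).indicator 1 s := fun n c =>
    hg.mul (measurable_one.indicator ((ρ n).measurableSet_preimage _))
  have hmL : ∀ n, ∀ c ∈ (ρ n).range, Measurable fun ω => (g (nearestDist b u ω) *
      (ρ n ⁻¹' {c}).indicator 1 (nearestDist b u ω)) * expNeg (otherSum b u (F c) ω) :=
    fun n c hc => ((hgi n c).comp hR).mul (measurable_expNeg.comp
      (measurable_otherSum hb.measurable u (hFW c (hrange n c hc)).measurable))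
  have hmR : ∀ n, ∀ c ∈ (ρ n).range, Measurable fun s => (g s * (ρ n ⁻¹' {c}).indicator 1 s) *
      (ENNReal.ofReal (2 * Real.pi * lam * s) * expNeg (exteriorExponent lam u (F c) s)) :=
    fun n c hc => (hgi n c).mul ((measurable_id.const_mul _).ennreal_ofReal.mul
      (measurable_expNeg.comp
        (measurable_exteriorExponent lam u (hFW c (hrange n c hc)).measurable)))
  have hstep : ∀ n, ∫⁻ ω, g (nearestDist b u ω) *
      expNeg (otherSum b u (F (ρ n (nearestDist b u ω))) ω) ∂μ
      = ∫⁻ s in Ioi 0, g s * (ENNReal.ofReal (2 * Real.pi * lam * s) *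
          expNeg (exteriorExponent lam u (F (ρ n s)) s)) := fun n => by
    simp_rw [hstepL, hstepR]
    rw [lintegral_finsetSum _ (hmL n), lintegral_finsetSum _ (hmR n)]
    exact Finset.sum_congr rfl fun c hc =>
      hb.lintegral_nearestDist_mul hlam u (hFW c (hrange n c hc)) (hgi n c)
  have hL : Tendsto (fun n => ∫⁻ ω, g (nearestDist b u ω) *
      expNeg (otherSum b u (F (ρ n (nearestDist b u ω))) ω) ∂μ) atTop
      (𝓝 (∫⁻ ω, g (nearestDist b u ω) *
        expNeg (otherSum b u (F (nearestDist b u ω)) ω) ∂μ)) := by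
    refine tendsto_lintegral_of_dominated_convergence (fun _ => 1) (fun n => ?_)
      (fun n => ae_of_all _ fun ω => mul_le_one' (hg1 _) (expNeg_le_one _)) (by simp)
      (ae_of_all _ fun ω => ?_)
    · simp_rw [hstepL]
      exact Finset.measurable_sum _ (hmL n)
    · refine ENNReal.Tendsto.const_mul ((continuous_expNeg.tendsto _).comp ?_)
        (Or.inr (ne_top_of_le_ne_top ENNReal.one_ne_top (hg1 _)))
      have hr0 : 0 ≤ nearestDist b u ω := dist_nonneg
      -- As an integral against counting measure, the series is open to monotone convergence.
      simp only [otherSum, ← lintegral_count]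
      refine lintegral_tendsto_of_tendsto_of_monotone
        (fun n => (measurable_of_countable _).aemeasurable)
        (ae_of_all _ fun i n m hnm => hmono _ _ _ (hρ0 _ _) (hρmono _ hnm))
        (ae_of_all _ fun i => ((hcont _).tendsto _).comp (hρlim _ hr0))
  have hRlim : Tendsto (fun n => ∫⁻ s in Ioi 0, g s * (ENNReal.ofReal (2 * Real.pi * lam * s) *
      expNeg (exteriorExponent lam u (F (ρ n s)) s))) atTop
      (𝓝 (∫⁻ s in Ioi 0, g s * (ENNReal.ofReal (2 * Real.pi * lam * s) *
        expNeg (exteriorExponent lam u (F s) s)))) := by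
    -- The dominating function is the density of the nearest distance itself, `2πλ s e^{-πλ s²}`.
    refine tendsto_lintegral_of_dominated_convergence (fun s => ENNReal.ofReal
      (2 * Real.pi * lam * (s * Real.exp (-(Real.pi * lam) * s ^ 2)))) (fun n => ?_)
      (fun n => (ae_restrict_iff' measurableSet_Ioi).2 (ae_of_all _ fun s hs => ?_)) ?_
      ((ae_restrict_iff' measurableSet_Ioi).2 (ae_of_all _ fun s hs => ?_))
    · simp_rw [hstepR]
      exact Finset.measurable_sum _ (hmR n)
    · have hs0 : 0 < s := hs
      calc g s * (ENNReal.ofReal (2 * Real.pi * lam * s) *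
            expNeg (exteriorExponent lam u (F (ρ n s)) s))
          ≤ 1 * (ENNReal.ofReal (2 * Real.pi * lam * s) *
            ENNReal.ofReal (Real.exp (-(Real.pi * lam * s ^ 2)))) := by
            gcongr
            · exact hg1 s
            · exact expNeg_exteriorExponent_le hlam u _ hs0.le
        _ = _ := by
            rw [one_mul, ← ENNReal.ofReal_mul (by positivity)]
            congr 1
            rw [neg_mul]
            ring
    · have hi : IntegrableOn (fun s => 2 * Real.pi * lam *
          (s * Real.exp (-(Real.pi * lam) * s ^ 2))) (Ioi 0) :=
        ((integrable_mul_exp_neg_mul_sq (mul_pos hpi hlam)).integrableOn).const_mul _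
      exact hi.lintegral_lt_top.ne
    · have hs0 : 0 < s := hs
      refine ENNReal.Tendsto.const_mul (ENNReal.Tendsto.const_mul
        ((continuous_expNeg.tendsto _).comp (ENNReal.Tendsto.const_mul ?_
          (Or.inr ENNReal.ofReal_ne_top))) (Or.inr ENNReal.ofReal_ne_top))
        (Or.inr (ne_top_of_le_ne_top ENNReal.one_ne_top (hg1 _)))
      have hd : Measurable fun x : Plane => dist u x := measurable_const.dist measurable_id
      refine lintegral_tendsto_of_tendsto_of_monotone (fun n => ?_)
        (ae_of_all _ fun x n m hnm => tsub_le_tsub_left (expNeg_antitone ?_) _)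
        (ae_of_all _ fun x => ENNReal.Tendsto.sub tendsto_const_nhds
          ((continuous_expNeg.tendsto _).comp ?_) (Or.inl ENNReal.one_ne_top))
      · exact (measurable_const.sub (measurable_expNeg.comp (Measurable.ite
          (measurableSet_le hd measurable_const) measurable_const
          ((hFm n s).comp hd)))).aemeasurable
      · by_cases hx : dist u x ≤ s
        · simp [hx]
        · simp only [hx, if_false]
          exact hmono _ _ _ (hρ0 _ _) (hρmono _ hnm)
      · by_cases hx : dist u x ≤ s
        · simp [hx]
        · simp only [hx, if_false]
          exact ((hcont _).tendsto _).comp (hρlim _ hs0.le)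
  exact tendsto_nhds_unique (hL.congr hstep) hRlim

end NearestLaw

/-! ### Exponential variables -/

lemma expMeasure_eq_withDensity (r : ℝ) :
    expMeasure r = volume.withDensity (exponentialPDF r) := rfl

lemma expMeasure_one_Ioi {t : ℝ} (ht : 0 ≤ t) :
    expMeasure 1 (Ioi t) = ENNReal.ofReal (Real.exp (-t)) := by
  have := isProbabilityMeasure_expMeasure one_pos
  rw [← compl_Iic, prob_compl_eq_one_sub measurableSet_Iic, ← ofReal_measureReal, ← cdf_eq_real,
    cdf_expMeasure_eq one_pos, if_pos ht, ← ENNReal.ofReal_one, ← ENNReal.ofReal_sub]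
  · congr 1
    ring_nf
  · have : Real.exp (-(1 * t)) ≤ 1 := Real.exp_le_one_iff.2 (by linarith)
    linarith

lemma ae_pos_expMeasure_one : ∀ᵐ x ∂(expMeasure 1), 0 < x := by
  have := isProbabilityMeasure_expMeasure one_pos
  have h1 : expMeasure 1 (Ioi 0) = 1 := by simp [expMeasure_one_Ioi le_rfl]
  exact (prob_compl_eq_zero_iff measurableSet_Ioi).2 h1

lemma expMeasure_one_Ici {t : ℝ} (ht : 0 ≤ t) :
    expMeasure 1 (Ici t) = ENNReal.ofReal (Real.exp (-t)) := by
  rw [← expMeasure_one_Ioi ht]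
  have hac : expMeasure 1 ≪ volume := withDensity_absolutelyContinuous _ _
  exact measure_congr (hac.ae_eq Ioi_ae_eq_Ici).symm

lemma expMeasure_one_le_ofReal (y : ENNReal) :
    expMeasure 1 {x | y ≤ ENNReal.ofReal x} = expNeg y := by
  have := isProbabilityMeasure_expMeasure one_pos
  by_cases hy : y = ⊤
  · simp [hy]
  obtain ⟨t, ht, rfl⟩ : ∃ t : ℝ, 0 ≤ t ∧ y = ENNReal.ofReal t :=
    ⟨y.toReal, ENNReal.toReal_nonneg, (ENNReal.ofReal_toReal hy).symm⟩
  rw [expNeg_ofReal ht]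
  -- At `t = 0` the set is the whole line rather than `[0, ∞)`, because `ENNReal.ofReal` truncates
  -- negative numbers to `0`.
  rcases ht.eq_or_lt with rfl | ht'
  · simp
  · rw [← expMeasure_one_Ici ht]
    congr 1
    ext x
    rw [mem_Ici, mem_ofPred_eq, ENNReal.ofReal_le_ofReal_iff', or_iff_left (not_le.2 ht')]

/-- Tilting the rate-one density by `e^{-ax}` gives `(1 + a)⁻¹` times the density of rate `1 + a`,
whose mass is one. -/
lemma lintegral_expNeg_expMeasure {a : ℝ} (ha : 0 ≤ a) :
    ∫⁻ x, expNeg (ENNReal.ofReal (a * x)) ∂(expMeasure 1) = ENNReal.ofReal (1 + a)⁻¹ := by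
  have hpdf : ∀ r : ℝ, Measurable (exponentialPDF r) := fun r =>
    (measurable_exponentialPDFReal r).ennreal_ofReal
  rw [expMeasure_eq_withDensity, lintegral_withDensity_eq_lintegral_mul _ (hpdf 1)
    (g := fun x => expNeg (ENNReal.ofReal (a * x)))
    (measurable_expNeg.comp (measurable_id.const_mul a).ennreal_ofReal)]
  have hpt : ∀ x, (exponentialPDF 1 * fun x => expNeg (ENNReal.ofReal (a * x))) x
      = ENNReal.ofReal (1 + a)⁻¹ * exponentialPDF (1 + a) x := fun x => by
    rw [Pi.mul_apply]
    rcases lt_or_ge x 0 with hx | hx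
    · rw [exponentialPDF_of_neg hx, exponentialPDF_of_neg hx, zero_mul, mul_zero]
    · rw [exponentialPDF_of_nonneg hx, exponentialPDF_of_nonneg hx,
        expNeg_ofReal (mul_nonneg ha hx), ← ENNReal.ofReal_mul (by positivity),
        ← ENNReal.ofReal_mul (by positivity), one_mul, ← Real.exp_add,
        inv_mul_cancel_left₀ (by positivity)]
      congr 2
      ring
  simp_rw [hpt]
  rw [lintegral_const_mul _ (hpdf _), lintegral_exponentialPDF_eq_one (by positivity), mul_one]

/-! ### Integrating out the fading -/

section Fading

variable {Ω : Type*} [MeasurableSpace Ω] {μ : Measure Ω}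
  {b : ℕ → Ω → Plane} {h : ℕ → Ω → ℝ}

lemma IsRayleighFading.ae_pos (hh : IsRayleighFading μ b h) : ∀ᵐ ω ∂μ, ∀ i, 0 < h i ω := by
  rw [ae_all_iff]
  intro i
  rw [(hh.law i).ae_iff (p := fun x => 0 < x) (measurableSet_Ioi.mem)]
  exact ae_pos_expMeasure_one

variable [IsProbabilityMeasure μ]

/-- Condition on `X`: the exponential tail at level `x` is `e^{-x}`. -/
lemma measure_le_of_indepFun {X Y : Ω → ENNReal} (hX : Measurable X) (hY : Measurable Y)
    (hXY : IndepFun X Y μ) (hlaw : μ.map Y = (expMeasure 1).map ENNReal.ofReal) :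
    μ {ω | X ω ≤ Y ω} = ∫⁻ ω, expNeg (X ω) ∂μ := by
  have hS : MeasurableSet {p : ENNReal × ENNReal | p.1 ≤ p.2} :=
    measurableSet_le measurable_fst measurable_snd
  have h1 : μ {ω | X ω ≤ Y ω} = (μ.map fun ω => (X ω, Y ω)) {p | p.1 ≤ p.2} := by
    rw [Measure.map_apply (hX.prodMk hY) hS]
    rfl
  rw [h1, (indepFun_iff_map_prod_eq_prod_map_map hX.aemeasurable hY.aemeasurable).1 hXY,
    Measure.prod_apply hS, lintegral_map (measurable_measure_prodMk_left hS) hX]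
  refine lintegral_congr fun ω => ?_
  rw [hlaw, Measure.map_apply ENNReal.measurable_ofReal (measurable_prodMk_left hS)]
  exact expMeasure_one_le_ofReal (X ω)

/-- The probability that an exponential variable exceeds a weighted sum of other independent
exponential variables. -/
lemma IsRayleighFading.measure_tsum_le (hh : IsRayleighFading μ b h) (c : ℕ) {a : ℕ → ℝ}
    (ha : ∀ i, 0 ≤ a i) {t : ENNReal} :
    μ {ω | t + ∑' i, (if i = c then 0 else ENNReal.ofReal (a i * h i ω)) ≤ ENNReal.ofReal (h c ω)}
      = expNeg t * expNeg (∑' i, if i = c then 0 else ENNReal.ofReal (Real.log (1 + a i))) := by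
  -- Index `c` keeps the bare gain and the others are weighted; as each coordinate is transformed
  -- separately, joint independence persists.
  let G : ℕ → ℝ → ENNReal := fun i x =>
    if i = c then ENNReal.ofReal x else ENNReal.ofReal (a i * x)
  have hG : ∀ i, Measurable (G i) := fun i => by
    by_cases hi : i = c
    · simpa [G, hi] using ENNReal.measurable_ofReal
    · simpa [G, hi] using (measurable_id.const_mul (a i)).ennreal_ofReal
  let X : ℕ → Ω → ENNReal := fun i => G i ∘ h i
  have hX : ∀ i, Measurable (X i) := fun i => (hG i).comp (hh.measurable i)
  have hind : iIndepFun X μ := hh.indep.comp G hG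
  have hXc : ∀ ω, X c ω = ENNReal.ofReal (h c ω) := fun ω => by simp [X, G]
  have hlawc : μ.map (X c) = (expMeasure 1).map ENNReal.ofReal := by
    have : X c = ENNReal.ofReal ∘ h c := funext hXc
    rw [this, ← Measure.map_map ENNReal.measurable_ofReal (hh.measurable c), (hh.law c).map_eq]
  have hXi : ∀ i, i ≠ c → ∫⁻ ω, expNeg (X i ω) ∂μ
      = expNeg (ENNReal.ofReal (Real.log (1 + a i))) := fun i hi => by
    have : ∀ ω, X i ω = ENNReal.ofReal (a i * h i ω) := fun ω => by simp [X, G, hi]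
    simp_rw [this]
    rw [expNeg_ofReal_log (ha i), ← lintegral_expNeg_expMeasure (ha i),
      (hh.law i).lintegral_comp (f := fun x => expNeg (ENNReal.ofReal (a i * x)))
        (measurable_expNeg.comp (measurable_id.const_mul _).ennreal_ofReal).aemeasurable]
  let S : ℕ → Finset ℕ := fun n => (Finset.range n).erase c
  have hsum : ∀ (n : ℕ) (f : ℕ → ENNReal),
      ∑ i ∈ Finset.range n, (if i = c then 0 else f i) = ∑ i ∈ S n, f i := fun n f => by
    rw [← Finset.sum_erase (a := c) (Finset.range n) (by simp)]
    exact Finset.sum_congr rfl fun i hi => if_neg (Finset.ne_of_mem_erase hi)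
  have hfin : ∀ n, μ {ω | t + ∑ i ∈ S n, X i ω ≤ X c ω}
      = expNeg t * expNeg (∑ i ∈ S n, ENNReal.ofReal (Real.log (1 + a i))) := fun n => by
    have hi : IndepFun (fun ω => t + ∑ i ∈ S n, X i ω) (X c) μ := by
      have h1 := hind.indepFun_finsetSum_of_notMem hX (Finset.notMem_erase c (Finset.range n))
      have h2 := h1.comp (measurable_const_add t) measurable_id
      convert h2 using 1
      · ext ω
        simp [S]
      · rfl
    rw [measure_le_of_indepFun (X := fun ω => t + ∑ i ∈ S n, X i ω)
      (measurable_const.add (Finset.measurable_sum _ fun i _ => hX i))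
      (hX c) hi hlawc]
    simp_rw [expNeg_add, expNeg_sum]
    rw [lintegral_const_mul _ (f := fun ω => ∏ i ∈ S n, expNeg (X i ω))
      (Finset.measurable_prod _ fun i _ => measurable_expNeg.comp (hX i))]
    congr 1
    refine (lintegral_prod_eq_prod_lintegral_of_indepFun (S n) (fun i => expNeg ∘ X i)
      (hind.comp (fun _ => expNeg) fun _ => measurable_expNeg)
      fun i => measurable_expNeg.comp (hX i)).trans ?_
    exact Finset.prod_congr rfl fun i hi => hXi i (Finset.ne_of_mem_erase hi)
  -- The events for finite sums decrease to the event for the series, so continuity from above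
  -- applies.
  have hSmono : Monotone S := fun n m hnm =>
    Finset.erase_subset_erase c (Finset.range_mono hnm)
  have hlimL : Tendsto (fun n => μ {ω | t + ∑ i ∈ S n, X i ω ≤ X c ω}) atTop
      (𝓝 (μ (⋂ n, {ω | t + ∑ i ∈ S n, X i ω ≤ X c ω}))) := by
    refine tendsto_measure_iInter_atTop (fun n => ?_) (fun n m hnm ω hω => ?_)
      ⟨0, measure_ne_top _ _⟩
    · exact (measurableSet_le (measurable_const.add (Finset.measurable_sum _ fun i _ => hX i))
        (hX c)).nullMeasurableSet
    · refine le_trans ?_ (mem_ofPred_eq ▸ hω :)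
      gcongr
      exact hSmono hnm
  have hset : (⋂ n, {ω | t + ∑ i ∈ S n, X i ω ≤ X c ω}) = {ω | t + ∑' i,
      (if i = c then 0 else ENNReal.ofReal (a i * h i ω)) ≤ ENNReal.ofReal (h c ω)} := by
    ext ω
    have he : ∀ n, ∑ i ∈ S n, X i ω
        = ∑ i ∈ Finset.range n, (if i = c then 0 else ENNReal.ofReal (a i * h i ω)) := fun n => by
      rw [hsum]
      refine Finset.sum_congr rfl fun i hi => ?_
      simp [X, G, Finset.ne_of_mem_erase hi]
    simp only [mem_iInter, mem_ofPred_eq, he, hXc]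
    have hlim : Tendsto (fun n => t + ∑ i ∈ Finset.range n,
        (if i = c then 0 else ENNReal.ofReal (a i * h i ω))) atTop
        (𝓝 (t + ∑' i, (if i = c then 0 else ENNReal.ofReal (a i * h i ω)))) :=
      tendsto_const_nhds.add ENNReal.summable.hasSum.tendsto_sum_nat
    refine ⟨fun hω => le_of_tendsto' hlim hω, fun hω n => le_trans ?_ hω⟩
    gcongr
    exact ENNReal.sum_le_tsum _
  have hlimR : Tendsto (fun n => expNeg t * expNeg (∑ i ∈ S n,
      ENNReal.ofReal (Real.log (1 + a i)))) atTop
      (𝓝 (expNeg t * expNeg (∑' i, if i = c then 0 else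
        ENNReal.ofReal (Real.log (1 + a i))))) := by
    refine ENNReal.Tendsto.const_mul ((continuous_expNeg.tendsto _).comp ?_)
      (Or.inr (expNeg_ne_top _))
    simp_rw [← hsum]
    exact ENNReal.summable.hasSum.tendsto_sum_nat
  rw [← hset]
  exact tendsto_nhds_unique (hlimL.congr hfin) hlimR

/-- Fubini for the independent gains and locations: the locations are frozen at `ω'` while the gains
are averaged over `ω`. -/
lemma IsRayleighFading.lintegral_eq_lintegral_lintegral (hh : IsRayleighFading μ b h)
    (hb : ∀ i, Measurable (b i)) {Φ : (ℕ → ℝ) × (ℕ → Plane) → ENNReal} (hΦ : Measurable Φ) :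
    ∫⁻ ω, Φ (fun i => h i ω, fun i => b i ω) ∂μ
      = ∫⁻ ω', ∫⁻ ω, Φ (fun i => h i ω, fun i => b i ω') ∂μ ∂μ := by
  have hH : Measurable fun ω i => h i ω := measurable_pi_lambda _ hh.measurable
  have hB : Measurable fun ω i => b i ω := measurable_pi_lambda _ hb
  rw [← lintegral_map (f := Φ) (g := fun ω => (fun i => h i ω, fun i => b i ω)) hΦ (hH.prodMk hB),
    (indepFun_iff_map_prod_eq_prod_map_map hH.aemeasurable hB.aemeasurable).1 hh.indep_locations,
    lintegral_prod_symm' _ hΦ, lintegral_map hΦ.lintegral_prod_left' hB]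
  refine lintegral_congr fun ω' => ?_
  exact lintegral_map (hΦ.comp measurable_prodMk_right) hH

end Fading

/-! ### Coverage and association with the locations frozen -/

section Coverage

variable {Ω : Type*} {b : ℕ → Ω → Plane} {h : ℕ → Ω → ℝ}

/-- Multiplying by `r^α / P` isolates the serving gain, the form needed to average over the fading.
Positive gains make the numerator nonzero, so division in `[0, ∞]` can be cleared even for a zero or
infinite denominator. -/
lemma le_sinr_iff {P α β noise : ℝ} (hP : 0 < P) (hβ : 0 < β) (u : Plane) {ω : Ω}
    (hR : 0 < nearestDist b u ω) (hpos : ∀ i, 0 < h i ω) :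
    ENNReal.ofReal β ≤ sinr b h u P α noise ω ↔
      ENNReal.ofReal (β * nearestDist b u ω ^ α * noise / P) + ∑' i,
        (if i = nearestIdx b u ω then 0 else
          ENNReal.ofReal (β * nearestDist b u ω ^ α * dist u (b i ω) ^ (-α) * h i ω))
      ≤ ENNReal.ofReal (h (nearestIdx b u ω) ω) := by
  set r := nearestDist b u ω with hr
  have hrα : 0 < r ^ α := Real.rpow_pos_of_pos hR _
  have hsig : 0 < P * nearestFading b h u ω * r ^ (-α) :=
    mul_pos (mul_pos hP (hpos _)) (Real.rpow_pos_of_pos hR _)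
  have hm : 0 < r ^ α / P := div_pos hrα hP
  rw [sinr, ENNReal.le_div_iff_mul_le (Or.inr (ENNReal.ofReal_pos.2 hsig).ne')
    (Or.inr ENNReal.ofReal_ne_top),
    ← ENNReal.mul_le_mul_iff_right (ENNReal.ofReal_pos.2 hm).ne' ENNReal.ofReal_ne_top,
    ← ENNReal.ofReal_mul hm.le]
  have h1 : r ^ α / P * (P * nearestFading b h u ω * r ^ (-α)) = h (nearestIdx b u ω) ω := by
    rw [Real.rpow_neg hR.le, nearestFading]
    field_simp
  have h2 : ENNReal.ofReal (r ^ α / P) * (ENNReal.ofReal β *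
      (interference b h u P α ω + ENNReal.ofReal noise))
      = ENNReal.ofReal (β * r ^ α * noise / P) + ∑' i, (if i = nearestIdx b u ω then 0 else
          ENNReal.ofReal (β * r ^ α * dist u (b i ω) ^ (-α) * h i ω)) := by
    rw [mul_add, mul_add, add_comm, interference,
      tsum_ne_nearestIdx b u ω fun i => ENNReal.ofReal (P * h i ω * dist u (b i ω) ^ (-α)),
      ← ENNReal.tsum_mul_left, ← ENNReal.tsum_mul_left, ← ENNReal.ofReal_mul hβ.le,
      ← ENNReal.ofReal_mul hm.le]
    congr 1
    · congr 1
      field_simp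
    · refine tsum_congr fun i => ?_
      split_ifs
      · simp
      · rw [← ENNReal.ofReal_mul hβ.le, ← ENNReal.ofReal_mul hm.le]
        congr 1
        field_simp
  rw [h1, h2]

variable [MeasurableSpace Ω] {μ : Measure Ω} {lam : ℝ}

lemma measurable_sinr (hb : ∀ i, Measurable (b i)) (hh : ∀ i, Measurable (h i)) (u : Plane)
    (P α noise : ℝ) : Measurable (sinr b h u P α noise) := by
  have hc : Measurable (nearestFading b h u) := measurable_eval_nearestIdx hb u hh
  have hR := measurable_nearestDist hb u
  have hI : Measurable (interference b h u P α) :=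
    measurable_tsum_ne_nearestIdx hb u
      (f := fun i ω => ENNReal.ofReal (P * h i ω * dist u (b i ω) ^ (-α))) fun i =>
      (((hh i).const_mul P).mul ((measurable_const.dist (hb i)).pow_const _)).ennreal_ofReal
  exact (((hc.const_mul P).mul (hR.pow_const _)).ennreal_ofReal).div (hI.add measurable_const)

lemma measurableSet_cellularEvent (hb : ∀ i, Measurable (b i)) (hh : ∀ i, Measurable (h i))
    (u : Plane) (k P α γ : ℝ) : MeasurableSet (cellularEvent b h u k P α γ) :=
  measurableSet_lt measurable_const
    (((measurable_eval_nearestIdx hb u hh).const_mul (k * P)).mul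
      ((measurable_nearestDist hb u).pow_const _))

/-- The logarithmic loss caused, after averaging over the fading, by an interferer at distance `v`
to a user at distance `ρ` from its base station. -/
def fadingLoss (α β ρ v : ℝ) : ENNReal :=
  ENNReal.ofReal (Real.log (1 + β * ρ ^ α * v ^ (-α)))

variable [IsProbabilityMeasure μ]

/-- Integrating out the fading in the coverage event. -/
lemma lintegral_nearestDist_mul_coverage (hb : IsPoissonPointProcess μ lam b)
    (hh : IsRayleighFading μ b h) (u : Plane) {P α β noise : ℝ} (hP : 0 < P) (hβ : 0 < β)
    {g : ℝ → ENNReal} (hg : Measurable g) :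
    ∫⁻ ω, g (nearestDist b u ω) *
        {s | ENNReal.ofReal β ≤ s}.indicator 1 (sinr b h u P α noise ω) ∂μ
      = ∫⁻ ω, g (nearestDist b u ω) *
          expNeg (ENNReal.ofReal (β * nearestDist b u ω ^ α * noise / P)) *
          expNeg (otherSum b u (fadingLoss α β (nearestDist b u ω)) ω) ∂μ := by
  -- Coordinates on the space of sequences: the integrand becomes a measurable function of the pair
  -- (gains, locations), as Fubini requires.
  let b' : ℕ → (ℕ → ℝ) × (ℕ → Plane) → Plane := fun i p => p.2 i
  let h' : ℕ → (ℕ → ℝ) × (ℕ → Plane) → ℝ := fun i p => p.1 i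
  have hb' : ∀ i, Measurable (b' i) := fun i => (measurable_pi_apply i).comp measurable_snd
  have hh' : ∀ i, Measurable (h' i) := fun i => (measurable_pi_apply i).comp measurable_fst
  have hΦ : Measurable fun p => g (nearestDist b' u p) *
      {s | ENNReal.ofReal β ≤ s}.indicator 1 (sinr b' h' u P α noise p) :=
    (hg.comp (measurable_nearestDist hb' u)).mul ((measurable_one.indicator measurableSet_Ici).comp
      (measurable_sinr hb' hh' u P α noise))
  refine (hh.lintegral_eq_lintegral_lintegral hb.measurable hΦ).trans ?_
  refine lintegral_congr_ae ?_
  filter_upwards [hb.ae_nearestDist_pos u] with ω' hω'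
  set r := nearestDist b u ω' with hr
  set c := nearestIdx b u ω' with hc
  have hr' : ∀ ω, nearestDist b' u (fun i => h i ω, fun i => b i ω') = r := fun ω => rfl
  have hc' : ∀ ω, nearestIdx b' u (fun i => h i ω, fun i => b i ω') = c := fun ω => rfl
  have hpt : ∀ᵐ ω ∂μ, {s | ENNReal.ofReal β ≤ s}.indicator (1 : ENNReal → ENNReal)
      (sinr b' h' u P α noise (fun i => h i ω, fun i => b i ω'))
      = {ω | ENNReal.ofReal (β * r ^ α * noise / P) + ∑' i, (if i = c then 0 else
          ENNReal.ofReal (β * r ^ α * dist u (b i ω') ^ (-α) * h i ω)) ≤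
          ENNReal.ofReal (h c ω)}.indicator 1 ω := by
    filter_upwards [hh.ae_pos] with ω hω
    have := le_sinr_iff (b := b') (h := h') (α := α) (noise := noise) hP hβ u
      (ω := (fun i => h i ω, fun i => b i ω')) hω' hω
    rw [hr', hc'] at this
    simp only [indicator, mem_ofPred_eq, this, Pi.one_apply]
    rfl
  have hset : MeasurableSet {ω | ENNReal.ofReal (β * r ^ α * noise / P) + ∑' i,
      (if i = c then 0 else ENNReal.ofReal (β * r ^ α * dist u (b i ω') ^ (-α) * h i ω)) ≤
        ENNReal.ofReal (h c ω)} := by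
    refine measurableSet_le ((Measurable.tsum fun i => ?_).const_add _)
      (hh.measurable c).ennreal_ofReal
    split_ifs
    · exact measurable_const
    · exact ((hh.measurable i).const_mul _).ennreal_ofReal
  simp_rw [hr']
  rw [lintegral_congr_ae (hpt.mono fun ω hω => congrArg (g r * ·) hω),
    lintegral_const_mul _ (measurable_one.indicator hset), lintegral_indicator_one hset,
    hh.measure_tsum_le c (fun i => mul_nonneg (mul_nonneg hβ.le (Real.rpow_nonneg hω'.le _))
      (Real.rpow_nonneg dist_nonneg _)), mul_assoc (g r),
    otherSum, tsum_ne_nearestIdx b u ω' fun i => fadingLoss α β r (dist u (b i ω'))]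
  rfl

/-- Integrating out the fading in the association event. -/
lemma lintegral_nearestDist_mul_cellularEvent (hb : IsPoissonPointProcess μ lam b)
    (hh : IsRayleighFading μ b h) (u : Plane) {k P α γ : ℝ} (hk : 0 < k) (hP : 0 < P) (hγ : 0 < γ)
    {g : ℝ → ENNReal} (hg : Measurable g) :
    ∫⁻ ω in cellularEvent b h u k P α γ, g (nearestDist b u ω) ∂μ
      = ∫⁻ ω, g (nearestDist b u ω) *
          ENNReal.ofReal (Real.exp (-(γ * nearestDist b u ω ^ α / (k * P)))) ∂μ := by
  let b' : ℕ → (ℕ → ℝ) × (ℕ → Plane) → Plane := fun i p => p.2 i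
  let h' : ℕ → (ℕ → ℝ) × (ℕ → Plane) → ℝ := fun i p => p.1 i
  have hb' : ∀ i, Measurable (b' i) := fun i => (measurable_pi_apply i).comp measurable_snd
  have hh' : ∀ i, Measurable (h' i) := fun i => (measurable_pi_apply i).comp measurable_fst
  have hΦ : Measurable ((cellularEvent b' h' u k P α γ).indicator
      fun p => g (nearestDist b' u p)) :=
    (hg.comp (measurable_nearestDist hb' u)).indicator
      (measurableSet_cellularEvent hb' hh' u k P α γ)
  rw [← lintegral_indicator (measurableSet_cellularEvent hb.measurable hh.measurable u k P α γ)]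
  refine (hh.lintegral_eq_lintegral_lintegral hb.measurable hΦ).trans ?_
  refine lintegral_congr_ae ?_
  filter_upwards [hb.ae_nearestDist_pos u] with ω' hω'
  set r := nearestDist b u ω' with hr
  set c := nearestIdx b u ω' with hc
  have hrα : 0 < r ^ α := Real.rpow_pos_of_pos hω' _
  have hkP : 0 < k * P := mul_pos hk hP
  have hpt : ∀ ω, (cellularEvent b' h' u k P α γ).indicator (fun p => g (nearestDist b' u p))
      (fun i => h i ω, fun i => b i ω')
      = g r * (h c ⁻¹' Ioi (γ * r ^ α / (k * P))).indicator 1 ω := fun ω => by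
    have hiff : (fun i => h i ω, fun i => b i ω') ∈ cellularEvent b' h' u k P α γ ↔
        ω ∈ h c ⁻¹' Ioi (γ * r ^ α / (k * P)) := by
      change γ < k * P * h c ω * r ^ (-α) ↔ γ * r ^ α / (k * P) < h c ω
      rw [div_lt_iff₀ hkP, Real.rpow_neg hω'.le, ← div_eq_mul_inv, lt_div_iff₀ hrα, mul_comm (h c ω)]
    by_cases hω : ω ∈ h c ⁻¹' Ioi (γ * r ^ α / (k * P))
    · rw [indicator_of_mem (hiff.2 hω), indicator_of_mem hω]
      simp [hr, nearestDist, nearestIdx, b']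
    · rw [indicator_of_notMem (fun hc => hω (hiff.1 hc)), indicator_of_notMem hω, mul_zero]
  simp_rw [hpt]
  rw [lintegral_const_mul _ (measurable_one.indicator (hh.measurable c measurableSet_Ioi)),
    lintegral_indicator_one (hh.measurable c measurableSet_Ioi),
    ← Measure.map_apply (hh.measurable c) measurableSet_Ioi, (hh.law c).map_eq,
    expMeasure_one_Ioi (by positivity)]

end Coverage

/-! ### The exponent of the interference -/

/-- The Laplace transform of the exponential law at `β (ρ / v) ^ α`. -/
def fadingFactor (α β ρ v : ℝ) : ℝ := (1 + β * ρ ^ α * v ^ (-α))⁻¹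

lemma one_sub_fadingFactor {α β ρ v : ℝ} (hβ : 0 ≤ β) (hρ : 0 ≤ ρ) (hv : 0 ≤ v) :
    1 - fadingFactor α β ρ v = β * ρ ^ α * v ^ (-α) / (1 + β * ρ ^ α * v ^ (-α)) := by
  have h1 : 0 ≤ ρ ^ α := Real.rpow_nonneg hρ _
  have h2 : 0 ≤ v ^ (-α) := Real.rpow_nonneg hv _
  have h3 : (1 + β * ρ ^ α * v ^ (-α)) ≠ 0 := by positivity
  rw [fadingFactor]
  field_simp
  ring

/-- Near `0` the integrand `v (1 - w v)` is at most `1`; at infinity it is at most a multiple of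
`v^{1-α}`, integrable because `α > 2`. -/
lemma isRadialLoss_fadingLoss {α β ρ : ℝ} (hα : 2 < α) (hβ : 0 < β) (hρ : 0 ≤ ρ) :
    IsRadialLoss (fadingLoss α β ρ) (fadingFactor α β ρ) := by
  have hA : 0 ≤ β * ρ ^ α := mul_nonneg hβ.le (Real.rpow_nonneg hρ _)
  have hden : ∀ v, 0 < v → 0 < 1 + β * ρ ^ α * v ^ (-α) := fun v hv => by
    have := Real.rpow_nonneg hv.le (-α)
    positivity
  have hmem : ∀ v, 0 < v → 0 < fadingFactor α β ρ v ∧ fadingFactor α β ρ v ≤ 1 := fun v hv => by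
    refine ⟨inv_pos.2 (hden v hv), inv_le_one_of_one_le₀ ?_⟩
    have := Real.rpow_nonneg hv.le (-α)
    have : 0 ≤ β * ρ ^ α * v ^ (-α) := by positivity
    linarith
  have hcont : ContinuousOn (fadingFactor α β ρ) (Ioi 0) := by
    refine ContinuousOn.inv₀ (continuousOn_const.add (continuousOn_const.mul ?_))
      fun v hv => (hden v hv).ne'
    exact continuousOn_id.rpow_const fun v hv => Or.inl (ne_of_gt hv)
  have hmeas : Measurable fun v => v * (1 - fadingFactor α β ρ v) := by
    unfold fadingFactor
    fun_prop
  refine ⟨?_, hcont, hmem, fun v hv => ?_, ?_⟩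
  · unfold fadingLoss
    fun_prop
  · exact expNeg_ofReal_log (mul_nonneg hA (Real.rpow_nonneg hv.le _))
  · rw [← Ioc_union_Ioi_eq_Ioi zero_le_one]
    refine IntegrableOn.union ?_ ?_
    · refine Integrable.mono' (integrableOn_const (C := (1 : ℝ)) (by simp))
        hmeas.aestronglyMeasurable
        ((ae_restrict_iff' measurableSet_Ioc).2 (ae_of_all _ fun v hv => ?_))
      obtain ⟨h1, h2⟩ := hmem v hv.1
      rw [Real.norm_of_nonneg (mul_nonneg hv.1.le (by linarith))]
      exact mul_le_one₀ hv.2 (by linarith) (by linarith)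
    · refine Integrable.mono' ((integrableOn_Ioi_rpow_of_lt (a := 1 - α) (by linarith)
        one_pos).const_mul (β * ρ ^ α)) hmeas.aestronglyMeasurable
        ((ae_restrict_iff' measurableSet_Ioi).2 (ae_of_all _ fun v hv => ?_))
      have hv0 : 0 < v := one_pos.trans hv
      have hvα := Real.rpow_nonneg hv0.le (-α)
      rw [Real.norm_of_nonneg (mul_nonneg hv0.le (by linarith [(hmem v hv0).2])),
        one_sub_fadingFactor hβ.le hρ hv0.le, sub_eq_add_neg, Real.rpow_add hv0, Real.rpow_one]
      calc v * (β * ρ ^ α * v ^ (-α) / (1 + β * ρ ^ α * v ^ (-α)))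
          ≤ v * (β * ρ ^ α * v ^ (-α)) := by
            gcongr
            refine div_le_self (by positivity) ?_
            have : 0 ≤ β * ρ ^ α * v ^ (-α) := by positivity
            linarith
        _ = β * ρ ^ α * (v * v ^ (-α)) := by ring

lemma fadingLoss_mono {α β : ℝ} (hα : 2 < α) (hβ : 0 < β) (v ρ ρ' : ℝ) (hρ : 0 ≤ ρ)
    (hρρ' : ρ ≤ ρ') (hv : 0 ≤ v) : fadingLoss α β ρ v ≤ fadingLoss α β ρ' v := by
  have h1 := Real.rpow_nonneg hρ α
  have h2 := Real.rpow_nonneg hv (-α)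
  refine ENNReal.ofReal_le_ofReal (Real.log_le_log (by positivity) ?_)
  gcongr

lemma integral_Ioi_fadingFactor {α β r : ℝ} (hα : 2 < α) (hβ : 0 < β) (hr : 0 < r) :
    ∫ v in Ioi r, v * (1 - fadingFactor α β r v)
      = (β * r ^ α) ^ (2 / α) * interferenceIntegral α β := by
  have hα0 : α ≠ 0 := by linarith
  have hrα : 0 < r ^ α := Real.rpow_pos_of_pos hr _
  have hA : 0 < β * r ^ α := mul_pos hβ hrα
  -- The substitution `v = c u` makes `β r^α v^{-α}` equal to `u^{-α}`, and the lower limit `r`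
  -- becomes `β^{-1/α}`.
  let c : ℝ := (β * r ^ α) ^ (1 / α)
  have hc : 0 < c := Real.rpow_pos_of_pos hA _
  have hcα : c ^ (-α) = (β * r ^ α)⁻¹ := by
    simp only [c]
    rw [← Real.rpow_mul hA.le, show 1 / α * -α = -1 by field_simp, Real.rpow_neg_one]
  have hcr : c * β ^ (-(1 / α)) = r := by
    simp only [c]
    rw [Real.mul_rpow hβ.le hrα.le, ← Real.rpow_mul hr.le, mul_one_div_cancel hα0, Real.rpow_one,
      mul_right_comm, ← Real.rpow_add hβ, add_neg_cancel, Real.rpow_zero, one_mul]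
  have hc2 : (β * r ^ α) ^ (2 / α) = c * c := by
    simp only [c]
    rw [← Real.rpow_add hA]
    congr 1
    ring
  have hsub := integral_comp_mul_left_Ioi (fun v => v * (1 - fadingFactor α β r v))
    (β ^ (-(1 / α))) hc
  rw [hcr, smul_eq_mul, eq_inv_mul_iff_mul_eq₀ hc.ne'] at hsub
  rw [← hsub, hc2, mul_assoc, interferenceIntegral,
    ← integral_const_mul c fun u => u / (1 + u ^ α)]
  refine congrArg (c * ·) (setIntegral_congr_fun measurableSet_Ioi fun x hx => ?_)
  have hx0 : 0 < x := (Real.rpow_pos_of_pos hβ _).trans hx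
  have hxα : 0 < x ^ α := Real.rpow_pos_of_pos hx0 _
  rw [one_sub_fadingFactor hβ.le hr.le (by positivity), Real.mul_rpow hc.le hx0.le, hcα,
    Real.rpow_neg hx0.le, mul_inv_cancel_left₀ hA.ne']
  field_simp
  ring

lemma expNeg_exteriorExponent_fadingLoss {lam α β r : ℝ} (hlam : 0 < lam) (u : Plane) (hα : 2 < α)
    (hβ : 0 < β) (hr : 0 < r) :
    expNeg (exteriorExponent lam u (fadingLoss α β r) r) = ENNReal.ofReal (Real.exp
      (-(Real.pi * lam * r ^ 2) -
        2 * Real.pi * lam * (β * r ^ α) ^ (2 / α) * interferenceIntegral α β)) := by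
  have hloss := isRadialLoss_fadingLoss hα hβ hr.le
  have hpi := Real.pi_pos
  rw [exteriorExponent_eq hlam u
    (fun v hv => ⟨(hloss.mem_Ioc v hv).1.le, (hloss.mem_Ioc v hv).2⟩) hloss.expNeg_eq
    hloss.integrableOn hr.le, expNeg_ofReal
    ((by positivity : 0 ≤ Real.pi * lam * r ^ 2).trans (radialExponent_ge hlam hloss.mem_Ioc hr.le)),
    radialExponent, integral_Ioi_fadingFactor hα hβ hr]
  congr 2
  ring

/-! ### The coverage probability -/

section CoverageFormula

variable {Ω : Type*} [MeasurableSpace Ω] {μ : Measure Ω} [IsProbabilityMeasure μ]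
  {lam : ℝ} {b : ℕ → Ω → Plane} {h : ℕ → Ω → ℝ}

/-- After averaging over the fading, the probability is the expectation of a strictly positive
variable. -/
lemma associationProb_pos (hb : IsPoissonPointProcess μ lam b) (hh : IsRayleighFading μ b h)
    (u : Plane) {k P α γ : ℝ} (hk : 0 < k) (hP : 0 < P) (hγ : 0 < γ) :
    0 < associationProb μ b h u k P α γ := by
  have h1 := lintegral_nearestDist_mul_cellularEvent (α := α) hb hh u hk hP hγ
    (g := fun _ => 1) measurable_const
  rw [setLIntegral_const, one_mul] at h1
  refine ENNReal.toReal_pos ?_ (measure_ne_top _ _)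
  rw [h1]
  simp only [one_mul]
  have hR := measurable_nearestDist hb.measurable u
  have hm : Measurable fun ω =>
      ENNReal.ofReal (Real.exp (-(γ * nearestDist b u ω ^ α / (k * P)))) := by
    fun_prop
  rw [Ne, lintegral_eq_zero_iff hm]
  intro h0
  have : ∀ᵐ ω ∂μ, False := by
    filter_upwards [h0] with ω hω
    exact (ENNReal.ofReal_pos.2 (Real.exp_pos _)).ne' hω
  simp [IsProbabilityMeasure.ne_zero] at this

/-- The coverage probability as an expectation over the nearest distance and the coverage event. -/
lemma coverageProb_eq_toReal_lintegral (hb : IsPoissonPointProcess μ lam b)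
    (hh : IsRayleighFading μ b h) (u : Plane) {k P α γ noise β : ℝ} (hk : 0 < k) (hP : 0 < P)
    (hγ : 0 < γ) :
    coverageProb μ b h u k P α γ noise β = (associationProb μ b h u k P α γ)⁻¹ *
      (∫⁻ ω, ENNReal.ofReal (Real.exp (-(γ * nearestDist b u ω ^ α / (k * P)))) *
        {s | ENNReal.ofReal β ≤ s}.indicator 1 (sinr b h u P α noise ω) ∂μ).toReal := by
  have hR := measurable_nearestDist hb.measurable u
  have hS := measurable_sinr hb.measurable hh.measurable u P α noise
  -- `q r` is the conditional probability of association given nearest distance `r`.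
  let q : ℝ → ENNReal := fun r => ENNReal.ofReal (Real.exp (-(γ * r ^ α / (k * P))))
  have hq : Measurable q := by
    simp only [q]
    fun_prop
  let κ := condDistrib (sinr b h u P α noise) (nearestDist b u) μ
  have hT : MeasurableSet {s : ENNReal | ENNReal.ofReal β ≤ s} := measurableSet_Ici
  have hκ : Measurable fun x => κ x {s | ENNReal.ofReal β ≤ s} := κ.measurable_coe hT
  have h1 : coverageProb μ b h u k P α γ noise β = (∫⁻ x, κ x {s | ENNReal.ofReal β ≤ s}
      ∂(servingDistLaw μ b h u k P α γ)).toReal :=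
    integral_toReal hκ.aemeasurable (ae_of_all _ fun x => measure_lt_top _ _)
  have h2 : ∫⁻ x, κ x {s | ENNReal.ofReal β ≤ s} ∂(servingDistLaw μ b h u k P α γ)
      = (μ (cellularEvent b h u k P α γ))⁻¹ *
        ∫⁻ ω, κ (nearestDist b u ω) {s | ENNReal.ofReal β ≤ s} * q (nearestDist b u ω) ∂μ := by
    rw [servingDistLaw, lintegral_map hκ hR, ProbabilityTheory.cond, lintegral_smul_measure,
      smul_eq_mul, lintegral_nearestDist_mul_cellularEvent hb hh u hk hP hγ hκ]
  -- The joint law of distance and SINR is the law of the distance composed with `κ`, so the choice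
  -- of version of `κ` is immaterial.
  have h3 : ∫⁻ ω, κ (nearestDist b u ω) {s | ENNReal.ofReal β ≤ s} * q (nearestDist b u ω) ∂μ
      = ∫⁻ ω, q (nearestDist b u ω) *
        {s | ENNReal.ofReal β ≤ s}.indicator 1 (sinr b h u P α noise ω) ∂μ := by
    have hf : Measurable fun p : ℝ × ENNReal =>
        q p.1 * {s | ENNReal.ofReal β ≤ s}.indicator 1 p.2 :=
      (hq.comp measurable_fst).mul ((measurable_one.indicator hT).comp measurable_snd)
    rw [← lintegral_map (f := fun x => κ x {s | ENNReal.ofReal β ≤ s} * q x) (hκ.mul hq) hR,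
      ← lintegral_map (f := fun p : ℝ × ENNReal =>
        q p.1 * {s | ENNReal.ofReal β ≤ s}.indicator 1 p.2)
        (g := fun ω => (nearestDist b u ω, sinr b h u P α noise ω)) hf (hR.prodMk hS),
      ← compProd_map_condDistrib hS.aemeasurable, Measure.lintegral_compProd hf]
    refine lintegral_congr fun x => ?_
    simp only []
    rw [lintegral_const_mul _ (measurable_one.indicator hT), lintegral_indicator_one hT, mul_comm]
  rw [h1, h2, h3, ENNReal.toReal_mul, ENNReal.toReal_inv]
  rfl

theorem coverageProb_eq (hb : IsPoissonPointProcess μ lam b) (hh : IsRayleighFading μ b h)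
    (u : Plane) {k P γ α β noise : ℝ} (hlam : 0 < lam) (hk : 0 < k) (hP : 0 < P) (hγ : 0 < γ)
    (hα : 2 < α) (hβ : 0 < β) (hn : 0 ≤ noise) :
    coverageProb μ b h u k P α γ noise β =
      2 * Real.pi * lam / associationProb μ b h u k P α γ *
        ∫ r in Ioi (0 : ℝ), r * Real.exp (-(Real.pi * lam * r ^ 2)) *
          Real.exp (-(β * noise * r ^ α / P) - γ * r ^ α / (k * P)
            - 2 * Real.pi * lam * (β * r ^ α) ^ (2 / α) * interferenceIntegral α β) := by
  have hpi := Real.pi_pos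
  let q : ℝ → ENNReal := fun r => ENNReal.ofReal (Real.exp (-(γ * r ^ α / (k * P))))
  have hq : Measurable q := by
    simp only [q]
    fun_prop
  -- The absolute values change nothing at distances; they make the bound `g ≤ 1`, monotonicity and
  -- continuity hold at all real arguments, as the diagonal lemma demands.
  let g : ℝ → ENNReal := fun r => ENNReal.ofReal (Real.exp (-(γ * |r| ^ α / (k * P)))) *
    expNeg (ENNReal.ofReal (β * |r| ^ α * noise / P))
  have hg : Measurable g := by
    simp only [g]
    fun_prop
  have hg1 : ∀ r, g r ≤ 1 := fun r => by
    refine mul_le_one' (ENNReal.ofReal_le_one.2 (Real.exp_le_one_iff.2 ?_)) (expNeg_le_one _)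
    have := Real.rpow_nonneg (abs_nonneg r) α
    have : 0 ≤ γ * |r| ^ α / (k * P) := by positivity
    linarith
  have hF : ∀ ρ, 0 ≤ ρ → IsRadialLoss (fun v => fadingLoss α β |ρ| |v|) (fadingFactor α β ρ) := by
    intro ρ hρ
    have h0 := isRadialLoss_fadingLoss hα hβ hρ
    rw [abs_of_nonneg hρ]
    exact ⟨h0.measurable.comp measurable_norm, h0.continuousOn, h0.mem_Ioc,
      fun v hv => by rw [abs_of_pos hv, h0.expNeg_eq v hv], h0.integrableOn⟩
  have hdiag := hb.lintegral_nearestDist_mul_diag hlam u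
    (F := fun ρ v => fadingLoss α β |ρ| |v|) hF
    (fun v ρ ρ' hρ hρρ' => fadingLoss_mono hα hβ _ _ _ (abs_nonneg _)
      (abs_le_abs_of_nonneg hρ hρρ') (abs_nonneg v))
    (fun v => by
      have h2 := Real.rpow_nonneg (abs_nonneg v) (-α)
      have hc : Continuous fun ρ : ℝ => 1 + β * |ρ| ^ α * |v| ^ (-α) :=
        continuous_const.add ((continuous_const.mul (continuous_abs.rpow_const fun _ =>
          Or.inr (by linarith))).mul continuous_const)
      exact ENNReal.continuous_ofReal.comp (hc.log fun ρ => by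
        have := Real.rpow_nonneg (abs_nonneg ρ) α
        positivity)) hg hg1
  have hE : ∫⁻ ω, ENNReal.ofReal (Real.exp (-(γ * nearestDist b u ω ^ α / (k * P)))) *
        {s | ENNReal.ofReal β ≤ s}.indicator 1 (sinr b h u P α noise ω) ∂μ
      = ∫⁻ r in Ioi (0 : ℝ), ENNReal.ofReal (2 * Real.pi * lam *
        (r * Real.exp (-(Real.pi * lam * r ^ 2)) *
          Real.exp (-(β * noise * r ^ α / P) - γ * r ^ α / (k * P)
            - 2 * Real.pi * lam * (β * r ^ α) ^ (2 / α) * interferenceIntegral α β))) := by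
    rw [lintegral_nearestDist_mul_coverage hb hh u hP hβ hq]
    refine Eq.trans (lintegral_congr fun ω => ?_) (hdiag.trans
      (setLIntegral_congr_fun measurableSet_Ioi fun r hr => ?_))
    · have h0 : |nearestDist b u ω| = nearestDist b u ω := abs_of_nonneg dist_nonneg
      simp only [g, q, h0, otherSum, abs_of_nonneg (dist_nonneg (x := u))]
    · have hr0 : 0 < r := hr
      have hrα := Real.rpow_pos_of_pos hr0 α
      have hext : exteriorExponent lam u (fun v => fadingLoss α β r |v|) r
          = exteriorExponent lam u (fadingLoss α β r) r := by
        simp only [exteriorExponent, abs_of_nonneg (dist_nonneg (x := u))]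
      simp only [g, abs_of_pos hr0]
      rw [hext, expNeg_exteriorExponent_fadingLoss hlam u hα hβ hr0,
        expNeg_ofReal (by positivity), ← ENNReal.ofReal_mul (by positivity),
        ← ENNReal.ofReal_mul (by positivity), ← ENNReal.ofReal_mul (by positivity)]
      congr 1
      rw [show ∀ a b c d : ℝ, a * b * (c * d) = c * (a * b * d) by intros; ring, ← Real.exp_add,
        ← Real.exp_add, mul_assoc r, ← Real.exp_add, ← mul_assoc]
      congr 2
      ring
  rw [coverageProb_eq_toReal_lintegral hb hh u hk hP hγ, hE, ← integral_eq_lintegral_of_nonneg_ae,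
    integral_const_mul]
  · ring
  · refine (ae_restrict_iff' measurableSet_Ioi).2 (ae_of_all _ fun r hr => ?_)
    have hr0 : 0 < r := hr
    simp only [Pi.zero_apply]
    positivity
  · refine Measurable.aestronglyMeasurable ?_
    fun_prop

end CoverageFormula

/-! ### The case `α = 4` -/

/-- An antiderivative is `arctan (x²) / 2`; at the lower limit `x² = 1 / √β`, and `arctan (1 / √β) =
π/2 - arctan √β`. -/
lemma interferenceIntegral_four {β : ℝ} (hβ : 0 < β) :
    interferenceIntegral 4 β = Real.arctan (Real.sqrt β) / 2 := by
  have ha : 0 < β ^ (-(1 / (4 : ℝ))) := Real.rpow_pos_of_pos hβ _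
  have ha2 : (β ^ (-(1 / (4 : ℝ)))) ^ 2 = (Real.sqrt β)⁻¹ := by
    rw [← Real.rpow_natCast, ← Real.rpow_mul hβ.le, Real.sqrt_eq_rpow, ← Real.rpow_neg hβ.le]
    congr 1
    norm_num
  have hd : ∀ x : ℝ, HasDerivAt (fun x => Real.arctan (x ^ 2) / 2) (x / (1 + x ^ (4 : ℝ))) x := by
    intro x
    refine ((hasDerivAt_pow 2 x).arctan.div_const 2).congr_deriv ?_
    rw [show x ^ (4 : ℝ) = (x ^ 2) ^ 2 by rw [← pow_mul]; exact_mod_cast Real.rpow_natCast x 4]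
    push_cast
    field_simp
  have hlim : Tendsto (fun x : ℝ => Real.arctan (x ^ 2) / 2) atTop (𝓝 (Real.pi / 2 / 2)) :=
    ((Real.tendsto_arctan_atTop.mono_right nhdsWithin_le_nhds).comp
      (tendsto_pow_atTop two_ne_zero)).div_const 2
  rw [interferenceIntegral, integral_Ioi_of_hasDerivAt_of_nonneg (hd _).continuousAt.continuousWithinAt
    (fun x _ => hd x) (fun x hx => ?_) hlim, ha2, Real.arctan_inv_of_pos (Real.sqrt_pos.2 hβ)]
  · ring
  · have hx0 : 0 < x := ha.trans hx
    have := Real.rpow_pos_of_pos hx0 4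
    positivity

lemma integral_mul_exp_neg_sq_sub_pow_four (c : ℝ) {m : ℝ} (hm : 0 < m) :
    ∫ r in Ioi (0 : ℝ), r * Real.exp (-(c * r ^ 2) - r ^ 4 / (4 * m ^ 2))
      = m * Real.exp (c ^ 2 * m ^ 2) * (Real.sqrt Real.pi / 2) *
        (1 - probabilityIntegral (c * m)) := by
  have hcont : Continuous fun t : ℝ => Real.exp (-t ^ 2) := by fun_prop
  let E : ℝ → ℝ := fun x => ∫ t in (0 : ℝ)..x, Real.exp (-t ^ 2)
  have hE : ∀ x, HasDerivAt E (Real.exp (-x ^ 2)) x := fun x =>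
    intervalIntegral.integral_hasDerivAt_right (hcont.intervalIntegrable _ _)
      hcont.stronglyMeasurable.stronglyMeasurableAtFilter hcont.continuousAt
  have hElim : Tendsto E atTop (𝓝 (Real.sqrt Real.pi / 2)) := by
    have h1 := integral_gaussian_Ioi 1
    have h2 := (integrable_exp_neg_mul_sq one_pos).integrableOn (s := Ioi 0)
    simp only [neg_mul, one_mul, div_one] at h1 h2
    rw [← h1]
    exact intervalIntegral_tendsto_integral_Ioi 0 h2 tendsto_id
  -- Completing the square: `y² = c² m² + c r² + r⁴ / (4 m²)` and `dy = (r / m) dr`, so the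
  -- integrand is a Gaussian in `y`.
  let y : ℝ → ℝ := fun r => r ^ 2 / (2 * m) + c * m
  have hy : ∀ r, HasDerivAt y (r / m) r := fun r => by
    refine (((hasDerivAt_pow 2 r).div_const (2 * m)).add_const (c * m)).congr_deriv ?_
    push_cast
    field_simp
  have hylim : Tendsto y atTop atTop :=
    tendsto_atTop_add_const_right _ _ ((tendsto_pow_atTop two_ne_zero).atTop_div_const
      (by positivity))
  have hd : ∀ r, HasDerivAt (fun r => m * Real.exp (c ^ 2 * m ^ 2) * E (y r))
      (r * Real.exp (-(c * r ^ 2) - r ^ 4 / (4 * m ^ 2))) r := fun r => by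
    refine (((hE (y r)).comp r (hy r)).const_mul _).congr_deriv ?_
    have : -(c * r ^ 2) - r ^ 4 / (4 * m ^ 2) = c ^ 2 * m ^ 2 + -(y r) ^ 2 := by
      simp only [y]
      field_simp
      ring
    rw [this, Real.exp_add]
    field_simp
  rw [integral_Ioi_of_hasDerivAt_of_nonneg (hd 0).continuousAt.continuousWithinAt
    (fun r _ => hd r) (fun r hr => mul_nonneg (mem_Ioi.1 hr).le (Real.exp_pos _).le)
    ((hElim.comp hylim).const_mul _)]
  have h0 : y 0 = c * m := by simp [y]
  have hpi : Real.sqrt Real.pi ≠ 0 := (Real.sqrt_pos.2 Real.pi_pos).ne'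
  rw [h0, probabilityIntegral]
  change _ - _ * E (c * m) = _ * (1 - _ * E (c * m))
  field_simp

lemma integral_coverage_four {lam k P γ β noise : ℝ} (hk : 0 < k) (hP : 0 < P)
    (hγ : 0 < γ) (hβ : 0 < β) (hn : 0 ≤ noise) :
    2 * ∫ r in Ioi (0 : ℝ), r * Real.exp (-(Real.pi * lam * r ^ 2)) *
        Real.exp (-(β * noise * r ^ (4 : ℝ) / P) - γ * r ^ (4 : ℝ) / (k * P)
          - 2 * Real.pi * lam * (β * r ^ (4 : ℝ)) ^ (2 / (4 : ℝ)) * interferenceIntegral 4 β)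
      = Real.sqrt (Real.pi * k * P / (4 * (k * β * noise + γ))) *
        Real.exp (k * P * Real.pi ^ 2 * lam ^ 2 / (4 * (k * β * noise + γ)) *
          (Real.sqrt β * Real.arctan (Real.sqrt β) + 1) ^ 2) *
        (1 - probabilityIntegral (Real.pi * lam * (1 + Real.sqrt β * Real.arctan (Real.sqrt β)) *
          Real.sqrt (k * P / (4 * (k * β * noise + γ))))) := by
  have hD : 0 < k * β * noise + γ := by positivity
  have hm2 : 0 < k * P / (4 * (k * β * noise + γ)) := by positivity
  -- `1 / (4 m²)` is the coefficient `β·noise/P + γ/(kP)` of `r⁴`, and `c` below collects the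
  -- coefficient of `r²` from the void probability and the interference.
  set m := Real.sqrt (k * P / (4 * (k * β * noise + γ))) with hm
  have hm0 : 0 < m := Real.sqrt_pos.2 hm2
  have hmsq : m ^ 2 = k * P / (4 * (k * β * noise + γ)) := Real.sq_sqrt hm2.le
  set c := Real.pi * lam * (1 + Real.sqrt β * Real.arctan (Real.sqrt β)) with hc
  have hint : ∫ r in Ioi (0 : ℝ), r * Real.exp (-(Real.pi * lam * r ^ 2)) *
        Real.exp (-(β * noise * r ^ (4 : ℝ) / P) - γ * r ^ (4 : ℝ) / (k * P)
          - 2 * Real.pi * lam * (β * r ^ (4 : ℝ)) ^ (2 / (4 : ℝ)) * interferenceIntegral 4 β)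
      = ∫ r in Ioi (0 : ℝ), r * Real.exp (-(c * r ^ 2) - r ^ 4 / (4 * m ^ 2)) := by
    refine setIntegral_congr_fun measurableSet_Ioi fun r hr => ?_
    have hr0 : 0 < r := hr
    have h4 : r ^ (4 : ℝ) = r ^ 4 := by exact_mod_cast Real.rpow_natCast r 4
    have hsq : (β * r ^ 4) ^ (2 / (4 : ℝ)) = Real.sqrt β * r ^ 2 := by
      rw [show (2 / (4 : ℝ)) = 1 / 2 by norm_num, ← Real.sqrt_eq_rpow, Real.sqrt_mul hβ.le,
        show r ^ 4 = (r ^ 2) ^ 2 by ring, Real.sqrt_sq (by positivity)]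
    simp only [h4]
    rw [hsq, interferenceIntegral_four hβ, mul_assoc, ← Real.exp_add, hmsq, hc]
    congr 2
    field_simp
    ring
  have hs : Real.sqrt (Real.pi * k * P / (4 * (k * β * noise + γ))) = Real.sqrt Real.pi * m := by
    rw [hm, ← Real.sqrt_mul Real.pi_pos.le]
    congr 1
    ring
  have he : k * P * Real.pi ^ 2 * lam ^ 2 / (4 * (k * β * noise + γ)) *
      (Real.sqrt β * Real.arctan (Real.sqrt β) + 1) ^ 2 = c ^ 2 * m ^ 2 := by
    rw [hmsq, hc]
    ring
  rw [hint, integral_mul_exp_neg_sq_sub_pow_four c hm0, hs, he]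
  ring

end CellularD2D

end

theorem proposition1 {Ω : Type*} [MeasurableSpace Ω] (μ : Measure Ω) [IsProbabilityMeasure μ]
    (lam k P γ α β σ : ℝ) (hlam : 0 < lam) (hk : 0 < k) (hP : 0 < P) (hγ : 0 < γ) (hα : 2 < α)
    (hβ : 0 < β)
    (b : ℕ → Ω → CellularD2D.Plane) (hb : CellularD2D.IsPoissonPointProcess μ lam b)
    (h : ℕ → Ω → ℝ) (hh : CellularD2D.IsRayleighFading μ b h) (u : CellularD2D.Plane) :
    0 < CellularD2D.associationProb μ b h u k P α γ ∧
    CellularD2D.coverageProb μ b h u k P α γ (σ ^ 2) β =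
      2 * Real.pi * lam / CellularD2D.associationProb μ b h u k P α γ *
        ∫ r in Ioi (0 : ℝ), r * Real.exp (-(Real.pi * lam * r ^ 2)) *
          Real.exp (-(β * σ ^ 2 * r ^ α / P) - γ * r ^ α / (k * P)
            - 2 * Real.pi * lam * (β * r ^ α) ^ (2 / α) *
              CellularD2D.interferenceIntegral α β) ∧
    (α = 4 →
      CellularD2D.coverageProb μ b h u k P α γ (σ ^ 2) β =
        Real.pi * lam / CellularD2D.associationProb μ b h u k P α γ *
          Real.sqrt (Real.pi * k * P / (4 * (k * β * σ ^ 2 + γ))) *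
          Real.exp (k * P * Real.pi ^ 2 * lam ^ 2 / (4 * (k * β * σ ^ 2 + γ)) *
            (Real.sqrt β * Real.arctan (Real.sqrt β) + 1) ^ 2) *
          (1 - CellularD2D.probabilityIntegral
            (Real.pi * lam * (1 + Real.sqrt β * Real.arctan (Real.sqrt β)) *
              Real.sqrt (k * P / (4 * (k * β * σ ^ 2 + γ)))))) := by
  refine ⟨CellularD2D.associationProb_pos hb hh u hk hP hγ,
    CellularD2D.coverageProb_eq hb hh u hlam hk hP hγ hα hβ (sq_nonneg σ), ?_⟩
  rintro rfl
  rw [CellularD2D.coverageProb_eq hb hh u hlam hk hP hγ hα hβ (sq_nonneg σ),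
    show ∀ a I : ℝ, 2 * Real.pi * lam / a * I = Real.pi * lam / a * (2 * I) by intros; ring,
    CellularD2D.integral_coverage_four hk hP hγ hβ (sq_nonneg σ)]
  simp only [mul_assoc]
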